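/- For a finite alphabet $A$, a subshift is a closed set $X\subseteq A^{\mathbb Z}$ with $\sigma(X)=X$, where $\sigma(x)[i]=x[i+1]$; its language $L(X)$ is the set of all finite words occurring in points of $X$, and $X$ is called sofic if $L(X)$ is a regular language. Let $\mathrm{Aut}(X)$ be the group, under composition, of all bijective cellular automata $F:X\to X$, that is, bijections given by a local rule $F(x)[i]=f(x[i+m],\dots,x[i+a])$ with integers $m\le a$. For $R\subseteq\mathrm{Aut}(X)$ let $C(R)$ be the centralizer of $R$ in $\mathrm{Aut}(X)$. Let $k(X)\in\mathbb N\cup\{\infty,\bot\}$ be the minimal cardinality of a set $R\subseteq\mathrm{Aut}(X)$ with $C(R)=\langle\sigma\rangle$ if such a set exists, and $k(X)=\bot$ otherwise. For a nonempty set $S\subseteq\mathbb N=\{0,1,2,\dots\}$, the $S$-gap shift $X_S\subseteq\{0,1\}^{\mathbb Z}$ is the subshift whose language is the set of all subwords of finite concatenations of words from $\{01^n\mid n\in S\}$. **Theorem.** Let $S\subseteq\mathbb N$ be nonempty. If $X_S$ is not sofic, then $k(X_S)=\infty$. That is, there is a set $R\subseteq\mathrm{Aut}(X_S)$ with $C(R)=\langle\sigma\rangle$,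 but no finite set $R\subseteq\mathrm{Aut}(X_S)$ satisfies $C(R)=\langle\sigma\rangle$. -/

import Mathlib

namespace SymbolicShift

open SymbolicDynamics.FullShift

/-- The word `x[i] x[i+1] ⋯ x[i+n-1]`. -/
def subword {A : Type*} (x : ℤ → A) (i : ℤ) (n : ℕ) : List A :=
  List.ofFn fun k : Fin n => x (i + k)

/-- The language `L(X)` of a subshift: all finite subwords of points of `X`. -/
def language {A : Type*} [TopologicalSpace A] (X : Subshift A ℤ) : Language A :=
  {w | ∃ x ∈ X.carrier, ∃ (i : ℤ) (n : ℕ), w = subword x i n}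

/-- A subshift is sofic if its language is regular. -/
def IsSofic {A : Type*} [TopologicalSpace A] (X : Subshift A ℤ) : Prop :=
  (language X).IsRegular

/-- `F : X → X` is a cellular automaton: it is given by a local rule `f` with
memory `m` and anticipation `a`. -/
def IsCellularAutomaton {A : Type*} [TopologicalSpace A] (X : Subshift A ℤ)
    (F : X.carrier → X.carrier) : Prop :=
  ∃ m a : ℤ, m ≤ a ∧ ∃ f : (Set.Icc m a → A) → A,
    ∀ (x : X.carrier) (i : ℤ), (F x).1 i = f fun j => x.1 (i + j)

/-- The shift by `g` places, as a permutation of the points of `X`. -/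
def shiftPerm {A : Type*} [TopologicalSpace A] (X : Subshift A ℤ) (g : ℤ) :
    Equiv.Perm X.carrier where
  toFun x := ⟨shift g x.1, X.mapsTo g x.2⟩
  invFun x := ⟨shift (-g) x.1, X.mapsTo (-g) x.2⟩
  left_inv x := by ext i; simp
  right_inv x := by ext i; simp

/-- A map is a cellular automaton exactly if it is continuous and commutes with all shifts. -/
theorem isCellularAutomaton_iff {A : Type*} [TopologicalSpace A] [DiscreteTopology A]
    [Finite A] (X : Subshift A ℤ) (F : X.carrier → X.carrier) :
    IsCellularAutomaton X F ↔
      Continuous F ∧ ∀ (g : ℤ) (x : X.carrier), F (shiftPerm X g x) = shiftPerm X g (F x) := by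
  constructor
  · rintro ⟨m, a, -, f, hf⟩
    constructor
    · refine Continuous.subtype_mk (f := fun x => (F x).1) (continuous_pi fun i => ?_) _
      simp only [hf]
      exact (continuous_of_discreteTopology (f := f)).comp
        (continuous_pi fun j => (continuous_apply _).comp continuous_subtype_val)
    · intro g x
      ext i
      rw [hf]
      change _ = (F x).1 (g + i)
      rw [hf]
      simp [shiftPerm, add_assoc]
  · rintro ⟨hc, hs⟩
    have : CompactSpace X.carrier := isCompact_iff_compactSpace.mp X.isClosed.isCompact
    have hG : Continuous fun x : X.carrier => (F x).1 0 :=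
      (continuous_apply _).comp (continuous_subtype_val.comp hc)
    let K : ℕ → Set (X.carrier × X.carrier) := fun N =>
      {p | (F p.1).1 0 ≠ (F p.2).1 0 ∧ ∀ j ∈ Set.Icc (-(N : ℤ)) N, p.1.1 j = p.2.1 j}
    have hK : ∀ N, IsClosed (K N) := by
      intro N
      have h1 : IsClosed {p : X.carrier × X.carrier | (F p.1).1 0 ≠ (F p.2).1 0} := by
        have : Continuous fun p : X.carrier × X.carrier => ((F p.1).1 0, (F p.2).1 0) :=
          (hG.comp continuous_fst).prodMk (hG.comp continuous_snd)
        exact (isClosed_discrete {q : A × A | q.1 ≠ q.2}).preimage this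
      have h2 : IsClosed {p : X.carrier × X.carrier |
          ∀ j ∈ Set.Icc (-(N : ℤ)) N, p.1.1 j = p.2.1 j} := by
        simp only [Set.ofPred_forall]
        exact isClosed_iInter fun j => isClosed_iInter fun _ => isClosed_eq
          ((continuous_apply j).comp (continuous_subtype_val.comp continuous_fst))
          ((continuous_apply j).comp (continuous_subtype_val.comp continuous_snd))
      exact h1.inter h2
    have hN : ∃ N, K N = ∅ := by
      by_contra! h
      obtain ⟨p, hp⟩ := IsCompact.nonempty_iInter_of_sequence_nonempty_isCompact_isClosed K
        (fun N p hp => ⟨hp.1, fun j hj => hp.2 j ⟨by have := hj.1; push_cast; linarith,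
          by have := hj.2; push_cast; linarith⟩⟩) h (hK 0).isCompact hK
      simp only [Set.mem_iInter] at hp
      refine (hp 0).1 ?_
      have : p.1 = p.2 := by
        ext j
        exact (hp j.natAbs).2 j ⟨by omega, by omega⟩
      rw [this]
    obtain ⟨N, hN⟩ := hN
    classical
    refine ⟨-N, N, by omega, fun w =>
      if h : ∃ y : X.carrier, ∀ j : Set.Icc (-(N : ℤ)) N, y.1 j = w j then (F h.choose).1 0
      else w ⟨0, by simp⟩, ?_⟩
    intro x i
    have h : ∃ y : X.carrier, ∀ j : Set.Icc (-(N : ℤ)) N, y.1 j = x.1 (i + j) :=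
      ⟨shiftPerm X i x, fun j => rfl⟩
    beta_reduce
    rw [dif_pos h]
    have h1 : (F x).1 i = (F (shiftPerm X i x)).1 0 := by
      rw [hs]; simp [shiftPerm]
    rw [h1]
    by_contra hne
    have : (shiftPerm X i x, h.choose) ∈ K N :=
      ⟨hne, fun j hj => (h.choose_spec ⟨j, hj⟩).symm⟩
    rw [hN] at this
    exact this

/-- The group `Aut(X)` of all bijective cellular automata on `X`, under composition. -/
def Aut {A : Type*} [TopologicalSpace A] [DiscreteTopology A] [Finite A]
    (X : Subshift A ℤ) : Subgroup (Equiv.Perm X.carrier) where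
  carrier := {F | IsCellularAutomaton X F}
  one_mem' := (isCellularAutomaton_iff X _).2 ⟨continuous_id, fun _ _ => rfl⟩
  mul_mem' {F G} hF hG := by
    obtain ⟨hF1, hF2⟩ := (isCellularAutomaton_iff X _).1 hF
    obtain ⟨hG1, hG2⟩ := (isCellularAutomaton_iff X _).1 hG
    exact (isCellularAutomaton_iff X _).2
      ⟨hF1.comp hG1, fun g x => by simp [hF2, hG2]⟩
  inv_mem' {F} hF := by
    obtain ⟨hF1, hF2⟩ := (isCellularAutomaton_iff X _).1 hF
    have : CompactSpace X.carrier := isCompact_iff_compactSpace.mp X.isClosed.isCompact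
    refine (isCellularAutomaton_iff X _).2
      ⟨hF1.continuous_symm_of_equiv_compact_to_t2, fun g x => ?_⟩
    rw [Equiv.Perm.inv_eq_iff_eq, hF2]
    simp

/-- The shift map `σ`, `σ(x)[i] = x[i+1]`, as an element of `Aut(X)`. -/
def shiftAut {A : Type*} [TopologicalSpace A] [DiscreteTopology A] [Finite A]
    (X : Subshift A ℤ) : Aut X :=
  ⟨shiftPerm X 1, 0, 1, by norm_num, fun w => w ⟨1, by norm_num⟩, fun x i => by
    simp [shiftPerm, add_comm]⟩

/-- `C(R) = ⟨σ⟩`: the centralizer of `R` in `Aut(X)` is the subgroup generated by the shift. -/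
def CentralizerIsShifts {A : Type*} [TopologicalSpace A] [DiscreteTopology A] [Finite A]
    (X : Subshift A ℤ) (R : Set (Aut X)) : Prop :=
  Subgroup.centralizer R = Subgroup.zpowers (shiftAut X)

open Classical in
/-- The number `k(X) ∈ ℕ ∪ {∞, ⊥}`: the minimal cardinality of a set `R ⊆ Aut(X)` with
`C(R) = ⟨σ⟩` if such a set exists, and `⊥` otherwise. -/
noncomputable def k {A : Type*} [TopologicalSpace A] [DiscreteTopology A] [Finite A]
    (X : Subshift A ℤ) : WithBot ℕ∞ :=
  if ∃ R : Set (Aut X), CentralizerIsShifts X R then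
    ((sInf (Set.encard '' {R : Set (Aut X) | CentralizerIsShifts X R}) : ℕ∞) : WithBot ℕ∞)
  else ⊥

/-- The coded subshift generated by `L`: the points all of whose subwords are subwords of
elements of `L∗`. -/
def codedSubshift {A : Type*} [TopologicalSpace A] [DiscreteTopology A]
    (L : Language A) : Subshift A ℤ where
  carrier := {x | ∀ (i : ℤ) (n : ℕ), ∃ v ∈ KStar.kstar L, subword x i n <:+: v}
  isClosed := by
    simp only [Set.ofPred_forall]
    refine isClosed_iInter fun i => isClosed_iInter fun n => ?_
    have : Continuous fun (x : ℤ → A) (k : Fin n) => x (i + k) := by fun_prop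
    exact (isClosed_discrete
      {w : Fin n → A | ∃ v ∈ KStar.kstar L, List.ofFn w <:+: v}).preimage this
  mapsTo g x hx i n := by
    have h : subword (shift g x) i n = subword x (g + i) n := by
      simp [subword, add_assoc]
    rw [h]
    exact hx (g + i) n

theorem subword_add {A : Type*} (x : ℤ → A) (i : ℤ) (m n : ℕ) :
    subword x i (m + n) = subword x i m ++ subword x (i + m) n := by
  simp [subword, List.ofFn_add, add_assoc]

/-- The language of the coded subshift generated by a nonempty language of nonempty words is
the set of all subwords of elements of `L∗`. -/
theorem language_codedSubshift {A : Type*} [TopologicalSpace A] [DiscreteTopology A]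
    (L : Language A) (hL : ∃ l, l ∈ L) (hL' : [] ∉ L) :
    language (codedSubshift L) = {w | ∃ v ∈ KStar.kstar L, w <:+: v} := by
  ext w
  constructor
  · rintro ⟨x, hx, i, n, rfl⟩
    exact hx i n
  · rintro ⟨v, hv, a, b, rfl⟩
    obtain ⟨l, hl⟩ := hL
    obtain ⟨c, hc⟩ : ∃ c, c = b ++ l := ⟨_, rfl⟩
    obtain ⟨u, hu⟩ : ∃ u, u = a ++ w ++ c := ⟨_, rfl⟩
    have huL : u ∈ KStar.kstar L := by
      rw [hu, hc, ← List.append_assoc, ← kstar_mul_kstar L]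
      refine Language.append_mem_mul hv ?_
      rw [Language.mem_kstar]
      exact ⟨[l], by simp, by simpa using hl⟩
    have hpos : 0 < u.length := by
      have : l ≠ [] := fun h => hL' (h ▸ hl)
      have := List.length_pos_iff.2 this
      simp only [hu, hc, List.length_append]
      omega
    have hpos' : (0 : ℤ) < u.length := by exact_mod_cast hpos
    have hlt : ∀ i : ℤ, (i % u.length).toNat < u.length := fun i => by
      have h1 := Int.emod_lt_of_pos i hpos'
      have h2 := Int.emod_nonneg i hpos'.ne'
      omega
    let x : ℤ → A := fun i => u[(i % u.length).toNat]'(hlt i)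
    have hper : ∀ (i q : ℤ), x (i + u.length * q) = x i := fun i q => by simp [x]
    have hsub : ∀ (i q : ℤ) (n : ℕ), subword x (i + u.length * q) n = subword x i n := by
      intro i q n
      simp only [subword, add_right_comm i _ _, hper]
    have h0 : subword x 0 u.length = u := by
      refine List.ext_getElem (by simp [subword]) fun k h1 h2 => ?_
      have : ((k : ℤ) % u.length).toNat = k := by
        rw [Int.emod_eq_of_lt (by omega) (by omega)]; simp
      simp [subword, x, this]
    have hK : ∀ K : ℕ, subword x 0 (u.length * K) ∈ KStar.kstar L := by
      intro K
      induction K with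
      | zero => simpa [subword] using Language.nil_mem_kstar L
      | succ K ih =>
        rw [mul_add, mul_one, subword_add, ← kstar_mul_kstar L]
        refine Language.append_mem_mul ih ?_
        have := hsub 0 K u.length
        push_cast
        rw [this, h0]
        exact huL
    refine ⟨x, fun i n => ?_, a.length, w.length, ?_⟩
    · obtain ⟨r, hr⟩ : ∃ r : ℕ, (r : ℤ) = i % u.length :=
        ⟨(i % u.length).toNat, by
          have h2 := Int.emod_nonneg i hpos'.ne'
          omega⟩
      have hi : subword x i n = subword x r n := by
        conv_lhs => rw [← Int.emod_add_mul_ediv i u.length, ← hr, hsub]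
      obtain ⟨d, hd⟩ : ∃ d, u.length * (r + n) = r + n + d :=
        Nat.exists_eq_add_of_le (Nat.le_mul_of_pos_left _ hpos)
      refine ⟨_, hK (r + n), ?_⟩
      rw [hi, hd, subword_add, subword_add, zero_add]
      exact ⟨_, _, rfl⟩
    · have h1 := h0
      have hlen : u.length = a.length + w.length + c.length := by
        simp [hu, add_assoc]
      rw [hlen, subword_add, subword_add, hu] at h1
      have h2 := List.append_inj_left h1 (by simp [subword])
      have h3 := List.append_inj_right h2 (by simp [subword])
      simpa using h3.symm

/-- The `S`-gap shift `X_S`: the coded subshift over `{0, 1}` generated by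
`{0 1ⁿ ∣ n ∈ S}`. -/
def gapShift (S : Set ℕ) : Subshift (Fin 2) ℤ :=
  codedSubshift {w | ∃ n ∈ S, w = 0 :: List.replicate n 1}

end SymbolicShift

/-! Call a maximal run of 1s between consecutive zeros a gap. If `S` is infinite, then `X_S`
consists of the points all of whose gaps have length in `S`. If `n ∈ S ↔ n + p ∈ S` for all large
`n` and some `p > 0`, then `X_S` is sofic. So a non-sofic `X_S` has an infinite `S` without such a
period, and this forces automorphisms to be rigid.

An automorphism `F` fixes the all-ones point, for otherwise `S` would be cofinite. Hence `F` sends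
points with a last (first) zero to points with a last (first) zero. Join a point with a last zero to
a point with a first zero by a long gap of length `n`: then `F` produces a gap of length `n + e`,
where `e` is the difference of the two displacements. The same argument for the inverse of `F` gives
`n ∈ S ↔ n + e ∈ S` for large `n`, so `e = 0` (`displacement_eq`). Up to a shift, `F` therefore
preserves every sufficiently long gap (`exists_isRigid`).

Given finitely many automorphisms, one bound serves them all. Exchanging two neighbouring gaps whose
lengths `a ≠ b` lie beyond it, behind a still longer gap `c`, is an automorphism that commutes with
all of them and is not a shift (`centralizer_ne_zpowers`).

Conversely, let a rigid `F` commute with every automorphism. An exchange may be made conditional on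
the word `W` that follows the two gaps. Commuting with it forces `F` to preserve `W`, because the
long gaps in front of `W` are visible both in a point and in its image. As `W` is arbitrary, `F` is
the identity (`IsRigid.eq_one`), so already `R = Aut(X_S)` has centralizer `⟨σ⟩`. -/

namespace SymbolicShift

open SymbolicDynamics.FullShift

/-! ### Factorization of products of generating words -/

/-- The generating words `0 1ⁿ`, `n ∈ S`, of the `S`-gap shift. -/
def gapBlocks (S : Set ℕ) : Language (Fin 2) :=
  {w | ∃ n ∈ S, w = 0 :: List.replicate n 1}

theorem mem_gapBlocks {S : Set ℕ} {w : List (Fin 2)} :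
    w ∈ gapBlocks S ↔ ∃ n ∈ S, w = 0 :: List.replicate n 1 := Iff.rfl

theorem cons_replicate_mem_kstar {S : Set ℕ} {n : ℕ} (hn : n ∈ S) :
    (0 :: List.replicate n 1 : List (Fin 2)) ∈ KStar.kstar (gapBlocks S) :=
  ⟨[0 :: List.replicate n 1], by simp, by simpa using ⟨n, hn, rfl⟩⟩

theorem append_mem_kstar {S : Set ℕ} {u v : List (Fin 2)} (hu : u ∈ KStar.kstar (gapBlocks S))
    (hv : v ∈ KStar.kstar (gapBlocks S)) : u ++ v ∈ KStar.kstar (gapBlocks S) := by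
  rw [← kstar_mul_kstar]
  exact Language.append_mem_mul hu hv

/-- Every occurrence of the letter `0` in a product of generating words starts a new factor. -/
theorem append_zero_cons_mem_kstar {S : Set ℕ} {p q : List (Fin 2)} :
    p ++ 0 :: q ∈ KStar.kstar (gapBlocks S) ↔
      p ∈ KStar.kstar (gapBlocks S) ∧ 0 :: q ∈ KStar.kstar (gapBlocks S) := by
  refine ⟨?_, fun h => append_mem_kstar h.1 h.2⟩
  rintro ⟨l, hl, hlS⟩
  induction l generalizing p with
  | nil => simp at hl
  | cons w l ih =>
    have hl' : l.flatten ∈ KStar.kstar (gapBlocks S) :=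
      ⟨l, rfl, fun y hy => hlS y (List.mem_cons_of_mem _ hy)⟩
    obtain ⟨n, hn, rfl⟩ := mem_gapBlocks.1 (hlS w (by simp))
    rw [List.flatten_cons, List.append_eq_append_iff] at hl
    rcases hl with ⟨c, h1, h2⟩ | ⟨c, h1, h2⟩
    · cases c with
      | nil =>
        simp only [List.append_nil, List.nil_append] at h1 h2
        rw [← h1, h2]
        exact ⟨cons_replicate_mem_kstar hn, hl'⟩
      | cons e c =>
        rw [List.cons_append, List.cons.injEq] at h2
        obtain ⟨rfl, rfl⟩ := h2
        cases p with
        | nil =>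
          refine ⟨Language.nil_mem_kstar _, ?_⟩
          rw [← List.cons_append]
          rw [List.nil_append] at h1
          rw [← h1]
          exact append_mem_kstar (cons_replicate_mem_kstar hn) hl'
        | cons d p =>
          rw [List.cons_append, List.cons.injEq] at h1
          have : (0 : Fin 2) ∈ List.replicate n 1 := by rw [h1.2]; simp
          simp at this
    · obtain ⟨h3, h4⟩ := ih h2.symm fun y hy => hlS y (List.mem_cons_of_mem _ hy)
      rw [h1]
      exact ⟨append_mem_kstar (cons_replicate_mem_kstar hn) h3, h4⟩

theorem cons_replicate_mem_kstar_iff {S : Set ℕ} {n : ℕ} :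
    (0 :: List.replicate n 1 : List (Fin 2)) ∈ KStar.kstar (gapBlocks S) ↔ n ∈ S := by
  refine ⟨?_, cons_replicate_mem_kstar⟩
  rintro ⟨l, hl, hlS⟩
  cases l with
  | nil => simp at hl
  | cons w l =>
    obtain ⟨m, hm, rfl⟩ := mem_gapBlocks.1 (hlS w (by simp))
    cases l with
    | nil =>
      have := congrArg List.length hl
      simp only [List.length_cons, List.length_replicate, List.flatten_cons, List.flatten_nil,
        List.append_nil] at this
      rwa [show n = m by omega]
    | cons w' l =>
      obtain ⟨m', hm', rfl⟩ := mem_gapBlocks.1 (hlS w' (by simp))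
      rw [List.flatten_cons, List.flatten_cons, List.cons_append, List.cons.injEq] at hl
      have : (0 : Fin 2) ∈ List.replicate n 1 := by rw [hl.2]; simp
      simp at this

theorem cons_replicate_append_mem_kstar_iff {S : Set ℕ} {n : ℕ} {q : List (Fin 2)} :
    0 :: (List.replicate n 1 ++ 0 :: q) ∈ KStar.kstar (gapBlocks S) ↔
      n ∈ S ∧ 0 :: q ∈ KStar.kstar (gapBlocks S) := by
  rw [← List.cons_append, append_zero_cons_mem_kstar, cons_replicate_mem_kstar_iff]

/-- A binary word is a power of `1`, possibly followed by a `0` and a further word. -/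
theorem eq_replicate_or_first_zero (w : List (Fin 2)) :
    (∃ n, w = List.replicate n 1) ∨ ∃ n q, w = List.replicate n 1 ++ 0 :: q := by
  induction w with
  | nil => exact .inl ⟨0, rfl⟩
  | cons e w ih =>
    have he : e = 0 ∨ e = 1 := by omega
    rcases he with rfl | rfl
    · exact .inr ⟨0, w, rfl⟩
    · rcases ih with ⟨n, rfl⟩ | ⟨n, q, rfl⟩
      · exact .inl ⟨n + 1, rfl⟩
      · exact .inr ⟨n + 1, q, rfl⟩

/-- A binary word is a power of `1`, possibly preceded by a further word and a `0`. -/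
theorem eq_replicate_or_last_zero (w : List (Fin 2)) :
    (∃ n, w = List.replicate n 1) ∨ ∃ n p, w = p ++ 0 :: List.replicate n 1 := by
  rcases eq_replicate_or_first_zero w.reverse with ⟨n, h⟩ | ⟨n, q, h⟩
  · exact .inl ⟨n, by simpa using congrArg List.reverse h⟩
  · exact .inr ⟨n, q.reverse, by simpa using congrArg List.reverse h⟩

/-! ### Eventually periodic `S` give sofic gap shifts -/

section EventuallyPeriodic

variable {S : Set ℕ} {N p : ℕ}

/-- The run of 1s may continue into `q`, but its total length is still at least `N`, and it is the
only factor affected by adding `p`. -/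
theorem cons_replicate_append_mem_kstar_add_iff (hp : ∀ n ≥ N, n ∈ S ↔ n + p ∈ S)
    {n : ℕ} (hn : N ≤ n) (q : List (Fin 2)) :
    0 :: (List.replicate n 1 ++ q) ∈ KStar.kstar (gapBlocks S) ↔
      0 :: (List.replicate (n + p) 1 ++ q) ∈ KStar.kstar (gapBlocks S) := by
  rcases eq_replicate_or_first_zero q with ⟨m, rfl⟩ | ⟨m, q, rfl⟩
  · rw [← List.replicate_add, ← List.replicate_add, cons_replicate_mem_kstar_iff,
      cons_replicate_mem_kstar_iff, hp (n + m) (by omega), add_right_comm]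
  · rw [← List.append_assoc, ← List.append_assoc, ← List.replicate_add, ← List.replicate_add,
      cons_replicate_append_mem_kstar_iff, cons_replicate_append_mem_kstar_iff,
      hp (n + m) (by omega), add_right_comm]

/-- The factors of products of generating words. -/
def gapLanguage (S : Set ℕ) : Language (Fin 2) :=
  {w | ∃ v ∈ KStar.kstar (gapBlocks S), w <:+: v}

theorem cons_replicate_append_mem_gapLanguage_add_iff (hp : ∀ n ≥ N, n ∈ S ↔ n + p ∈ S)
    {n : ℕ} (hn : N ≤ n) (y : List (Fin 2)) :
    0 :: (List.replicate n 1 ++ y) ∈ gapLanguage S ↔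
      0 :: (List.replicate (n + p) 1 ++ y) ∈ gapLanguage S := by
  have key : ∀ s t : List (Fin 2), s ++ 0 :: (List.replicate n 1 ++ y) ++ t ∈
      KStar.kstar (gapBlocks S) ↔ s ++ 0 :: (List.replicate (n + p) 1 ++ y) ++ t ∈
      KStar.kstar (gapBlocks S) := by
    intro s t
    simp only [List.append_assoc, List.cons_append, append_zero_cons_mem_kstar,
      cons_replicate_append_mem_kstar_add_iff hp hn]
  constructor
  · rintro ⟨v, hv, s, t, rfl⟩
    exact ⟨_, (key s t).1 hv, s, t, rfl⟩
  · rintro ⟨v, hv, s, t, rfl⟩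
    exact ⟨_, (key s t).2 hv, s, t, rfl⟩

/-- A left context can be cut at its last zero; if it has none, a block with exponent in `S` is put
in front. -/
theorem mem_gapLanguage_iff_append_zero (hS : S.Nonempty) (w : List (Fin 2)) :
    w ∈ gapLanguage S ↔ ∃ (j : ℕ) (t : List (Fin 2)),
      0 :: (List.replicate j 1 ++ (w ++ t)) ∈ KStar.kstar (gapBlocks S) := by
  constructor
  · rintro ⟨v, hv, s, t, rfl⟩
    obtain ⟨m, hm⟩ := hS
    rcases eq_replicate_or_last_zero s with ⟨j, rfl⟩ | ⟨j, s, rfl⟩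
    · refine ⟨m + j, t, ?_⟩
      have := append_mem_kstar (cons_replicate_mem_kstar hm) hv
      rw [List.replicate_add]
      simpa only [List.cons_append, List.append_assoc] using this
    · refine ⟨j, t, ?_⟩
      rw [List.append_assoc, List.append_assoc, List.cons_append,
        append_zero_cons_mem_kstar] at hv
      exact hv.2
  · rintro ⟨j, t, h⟩
    exact ⟨_, h, 0 :: List.replicate j 1, t, by simp⟩

theorem replicate_append_mem_gapLanguage_add_iff (hS : S.Nonempty)
    (hp : ∀ n ≥ N, n ∈ S ↔ n + p ∈ S) {n : ℕ} (hn : N ≤ n) (y : List (Fin 2)) :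
    List.replicate n 1 ++ y ∈ gapLanguage S ↔ List.replicate (n + p) 1 ++ y ∈ gapLanguage S := by
  rw [mem_gapLanguage_iff_append_zero hS, mem_gapLanguage_iff_append_zero hS]
  refine exists_congr fun j => exists_congr fun t => ?_
  have := cons_replicate_append_mem_kstar_add_iff hp (n := j + n) (by omega) (y ++ t)
  rw [add_assoc, List.replicate_add, List.replicate_add j] at this
  simpa only [List.append_assoc] using this

/-- A zero erases the past: what may follow depends only on the number of 1s after the last zero,
provided the word is admissible at all. -/
theorem leftQuotient_append_zero_cons {a : List (Fin 2)} {n : ℕ}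
    (h : a ++ 0 :: List.replicate n 1 ∈ gapLanguage S) :
    (gapLanguage S).leftQuotient (a ++ 0 :: List.replicate n 1) =
      {y | 0 :: (List.replicate n 1 ++ y) ∈ gapLanguage S} := by
  obtain ⟨v, hv, s, t, rfl⟩ := h
  simp only [List.append_assoc, List.cons_append] at hv
  rw [← List.append_assoc, append_zero_cons_mem_kstar] at hv
  ext y
  rw [Language.mem_leftQuotient]
  constructor
  · rintro ⟨v, hv', s', t', rfl⟩
    exact ⟨_, hv', s' ++ a, t', by simp⟩
  · rintro ⟨v, hv', s', t', rfl⟩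
    simp only [List.append_assoc, List.cons_append] at hv'
    rw [append_zero_cons_mem_kstar] at hv'
    exact ⟨_, append_mem_kstar hv.1 hv'.2, s, t', by simp⟩

theorem exists_lt_eq_of_eventually_periodic {α : Type*} {f : ℕ → α} (hp0 : 0 < p)
    (hf : ∀ n ≥ N, f n = f (n + p)) (n : ℕ) : ∃ m < N + p, f m = f n := by
  induction n using Nat.strong_induction_on with
  | _ n ih =>
    by_cases hn : n < N + p
    · exact ⟨n, hn, rfl⟩
    · obtain ⟨m, hm, h⟩ := ih (n - p) (by omega)
      refine ⟨m, hm, h.trans ?_⟩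
      rw [hf (n - p) (by omega), Nat.sub_add_cancel (by omega)]

/-- Myhill–Nerode: left quotients come from words `1ⁿ`, from admissible words ending in `0 1ⁿ`, or
are empty. In the first two families only `n < N + p` matters. -/
theorem isSofic_of_eventually_periodic (hS : S.Nonempty) (hp0 : 0 < p)
    (hp : ∀ n ≥ N, n ∈ S ↔ n + p ∈ S) : IsSofic (gapShift S) := by
  have hL : language (gapShift S) = gapLanguage S := by
    refine language_codedSubshift (gapBlocks S) ?_ ?_
    · obtain ⟨n, hn⟩ := hS
      exact ⟨_, n, hn, rfl⟩
    · rintro ⟨n, -, h⟩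
      simp at h
  rw [IsSofic, hL, Language.isRegular_iff_finite_range_leftQuotient]
  let f : ℕ → Language (Fin 2) := fun n => {y | List.replicate n 1 ++ y ∈ gapLanguage S}
  let g : ℕ → Language (Fin 2) := fun n => {y | 0 :: (List.replicate n 1 ++ y) ∈ gapLanguage S}
  have hf : ∀ n ≥ N, f n = f (n + p) := fun n hn => by
    ext y
    exact replicate_append_mem_gapLanguage_add_iff hS hp hn y
  have hg : ∀ n ≥ N, g n = g (n + p) := fun n hn => by
    ext y
    exact cons_replicate_append_mem_gapLanguage_add_iff hp hn y
  refine ((((Set.finite_Iio (N + p)).image f).union ((Set.finite_Iio (N + p)).image g)).union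
    (Set.finite_singleton (⊥ : Language (Fin 2)))).subset ?_
  rintro _ ⟨w, rfl⟩
  rcases eq_replicate_or_last_zero w with ⟨n, rfl⟩ | ⟨n, a, rfl⟩
  · obtain ⟨m, hm, h⟩ := exists_lt_eq_of_eventually_periodic hp0 hf n
    exact .inl (.inl ⟨m, hm, h⟩)
  · by_cases hw : a ++ 0 :: List.replicate n 1 ∈ gapLanguage S
    · obtain ⟨m, hm, h⟩ := exists_lt_eq_of_eventually_periodic hp0 hg n
      exact .inl (.inr ⟨m, hm, h.trans (leftQuotient_append_zero_cons hw).symm⟩)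
    · refine .inr ?_
      ext y
      rw [Language.mem_leftQuotient]
      refine iff_of_false ?_ (fun h => h)
      rintro ⟨v, hv, s, t, rfl⟩
      exact hw ⟨_, hv, s, y ++ t, by simp⟩

theorem infinite_of_not_isSofic (hS : S.Nonempty) (hX : ¬ IsSofic (gapShift S)) :
    S.Infinite := by
  intro hfin
  obtain ⟨M, hM⟩ := hfin.bddAbove
  refine hX (isSofic_of_eventually_periodic (N := M + 1) (p := 1) hS one_pos fun n hn => ?_)
  refine iff_of_false (fun h => ?_) (fun h => ?_)
  · have := hM h; omega
  · have := hM h; omega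

end EventuallyPeriodic

/-! ### Gaps and membership in the gap shift -/

/-- The points `i < j` are consecutive zeros of `x`. -/
structure IsGap (x : ℤ → Fin 2) (i j : ℤ) : Prop where
  lt : i < j
  left : x i = 0
  right : x j = 0
  ones : ∀ k, i < k → k < j → x k = 1

theorem subword_eq_of_isGap {x : ℤ → Fin 2} {i : ℤ} {n : ℕ} (h0 : x i = 0)
    (h1 : ∀ k, i < k → k < i + n + 1 → x k = 1) :
    subword x i (n + 1) = 0 :: List.replicate n 1 := by
  rw [subword, List.ofFn_succ]
  simp only [Fin.val_zero, Nat.cast_zero, add_zero, h0, List.cons.injEq, true_and]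
  rw [← List.ofFn_const]
  congr 1
  ext1 k
  exact h1 _ (by simp) (by simp)

theorem subword_ones {x : ℤ → Fin 2} {i : ℤ} {n : ℕ}
    (h1 : ∀ k, i ≤ k → k < i + n → x k = 1) : subword x i n = List.replicate n 1 := by
  rw [subword, ← List.ofFn_const]
  congr 1
  ext1 k
  exact h1 _ (by omega) (by have := k.2; omega)

theorem exists_first_zero_or_ones (x : ℤ → Fin 2) (i : ℤ) (n : ℕ) :
    (∀ k, i ≤ k → k < i + n → x k = 1) ∨
      ∃ m < n, x (i + m) = 0 ∧ ∀ k, i ≤ k → k < i + m → x k = 1 := by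
  by_cases h : ∃ m : ℕ, m < n ∧ x (i + m) = 0
  · classical
    refine .inr ⟨Nat.find h, (Nat.find_spec h).1, (Nat.find_spec h).2, fun k hk1 hk2 => ?_⟩
    have := Nat.find_min h (m := (k - i).toNat) (by omega)
    have hk : i + ((k - i).toNat : ℤ) = k := by omega
    rw [hk] at this
    have := (Nat.find_spec h).1
    by_contra hne
    have : x k = 0 := by omega
    have : (k - i).toNat < n := by omega
    tauto
  · push Not at h
    refine .inl fun k hk1 hk2 => ?_
    have := h (k - i).toNat (by omega)
    have hk : i + ((k - i).toNat : ℤ) = k := by omega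
    rw [hk] at this
    omega

/-- Induction from one zero to the next. The last run may be cut off by the window; as `S` is
infinite, it extends to a full block. -/
theorem exists_subword_append_mem_kstar {S : Set ℕ} (hS : S.Infinite) {x : ℤ → Fin 2}
    (hx : ∀ i j, IsGap x i j → ∃ n ∈ S, j = i + (n : ℤ) + 1) (n : ℕ) :
    ∀ i, x i = 0 → ∃ t, subword x i (n + 1) ++ t ∈ KStar.kstar (gapBlocks S) := by
  induction n using Nat.strong_induction_on with
  | _ n ih =>
    intro i hi
    rcases exists_first_zero_or_ones x (i + 1) n with h | ⟨m, hm, h0, h1⟩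
    · obtain ⟨M, hM, hnM⟩ := hS.exists_gt n
      refine ⟨List.replicate (M - n) 1, ?_⟩
      rw [subword_eq_of_isGap hi fun k h2 h3 => h k (by omega) (by omega), List.cons_append,
        ← List.replicate_add, Nat.add_sub_cancel' hnM.le]
      exact cons_replicate_mem_kstar hM
    · have hones : ∀ k, i < k → k < i + m + 1 → x k = 1 := fun k h2 h3 =>
        h1 k (by omega) (by omega)
      obtain ⟨t, ht⟩ := ih (n - m - 1) (by omega) (i + 1 + m) h0
      refine ⟨t, ?_⟩
      have hn : n + 1 = (m + 1) + (n - m - 1 + 1) := by omega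
      rw [hn, subword_add, subword_eq_of_isGap hi hones, List.append_assoc]
      refine append_mem_kstar (cons_replicate_mem_kstar ?_) ?_
      · obtain ⟨m', hm', h⟩ := hx i (i + 1 + m) ⟨by omega, hi, h0, fun k h2 h3 =>
          h1 k (by omega) (by omega)⟩
        rwa [show m = m' by omega]
      · rw [show i + ((m + 1 : ℕ) : ℤ) = i + 1 + m by push_cast; ring]
        exact ht

/-- For infinite `S`, a point belongs to the `S`-gap shift if and only if its gaps have
lengths in `S`. -/
theorem mem_gapShift_iff {S : Set ℕ} (hS : S.Infinite) {x : ℤ → Fin 2} :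
    x ∈ (gapShift S).carrier ↔ ∀ i j, IsGap x i j → ∃ n ∈ S, j = i + (n : ℤ) + 1 := by
  constructor
  · intro hx i j h
    obtain ⟨n, hn⟩ : ∃ n : ℕ, j = i + n + 1 := ⟨(j - i - 1).toNat, by have := h.lt; omega⟩
    refine ⟨n, ?_, hn⟩
    obtain ⟨v, hv, s, t, rfl⟩ : ∃ v ∈ KStar.kstar (gapBlocks S), _ <:+: v := hx i (n + 1 + 1)
    have h1 : subword x (i + ((n + 1 : ℕ) : ℤ)) 1 = [0] := by
      simp only [subword, List.ofFn_succ, List.ofFn_zero]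
      rw [← h.right, hn]
      simp [add_assoc]
    rw [subword_add, subword_eq_of_isGap h.left (by rw [← hn]; exact h.ones), h1] at hv
    simp only [List.append_assoc, List.cons_append, List.nil_append,
      append_zero_cons_mem_kstar] at hv
    exact (cons_replicate_append_mem_kstar_iff.1 hv.2).1
  · intro hx i n
    rcases exists_first_zero_or_ones x i n with h | ⟨m, hm, h0, h1⟩
    · obtain ⟨M, hM, hnM⟩ := hS.exists_gt n
      refine ⟨_, cons_replicate_mem_kstar hM, ?_⟩
      rw [subword_ones h]
      exact ⟨[0], List.replicate (M - n) 1, by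
        simp [Nat.add_sub_cancel' hnM.le]⟩
    · obtain ⟨M, hM, hmM⟩ := hS.exists_gt m
      obtain ⟨t, ht⟩ := exists_subword_append_mem_kstar hS hx (n - m - 1) _ h0
      refine ⟨_, append_mem_kstar (cons_replicate_mem_kstar hM) ht, ?_⟩
      rw [show n = m + (n - m - 1 + 1) by omega, subword_add, subword_ones h1,
        show m + (n - m - 1 + 1) - m - 1 = n - m - 1 by omega]
      refine ⟨0 :: List.replicate (M - m) 1, t, ?_⟩
      conv_rhs => rw [show M = (M - m) + m by omega, List.replicate_add]
      simp only [List.append_assoc, List.cons_append]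

/-! ### Cellular automata as maps of finite radius -/

section Local

variable {A : Type*} [TopologicalSpace A] {X : Subshift A ℤ}

/-- The value of `F x` at `i` depends, uniformly in `i`, only on `x` on `[i - r, i + r]`. -/
def IsLocal (r : ℕ) (F : X.carrier → X.carrier) : Prop :=
  ∀ (x y : X.carrier) (i j : ℤ), (∀ k, -(r : ℤ) ≤ k → k ≤ r → x.1 (i + k) = y.1 (j + k)) →
    (F x).1 i = (F y).1 j

theorem IsLocal.mono {r s : ℕ} {F : X.carrier → X.carrier} (hF : IsLocal r F) (h : r ≤ s) :
    IsLocal s F := fun x y i j hxy => hF x y i j fun k h1 h2 => hxy k (by omega) (by omega)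

theorem IsLocal.congr {r : ℕ} {F : X.carrier → X.carrier} (hF : IsLocal r F)
    {x y : X.carrier} {i : ℤ} (h : ∀ k, i - r ≤ k → k ≤ i + r → x.1 k = y.1 k) :
    (F x).1 i = (F y).1 i :=
  hF x y i i fun k h1 h2 => h (i + k) (by omega) (by omega)

theorem IsLocal.congr_shift {r : ℕ} {F : X.carrier → X.carrier} (hF : IsLocal r F)
    {x y : X.carrier} {i m : ℤ} (h : ∀ k, i - r ≤ k → k ≤ i + r → x.1 k = y.1 (k - m)) :
    (F x).1 i = (F y).1 (i - m) :=
  hF x y i (i - m) fun k h1 h2 => by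
    rw [h (i + k) (by omega) (by omega), sub_add_eq_add_sub]

theorem IsCellularAutomaton.exists_isLocal {F : X.carrier → X.carrier}
    (hF : IsCellularAutomaton X F) : ∃ r, IsLocal r F := by
  obtain ⟨m, a, -, f, hf⟩ := hF
  refine ⟨m.natAbs + a.natAbs, fun x y i j h => ?_⟩
  rw [hf, hf]
  congr 1
  ext1 k
  obtain ⟨h1, h2⟩ := k.2
  exact h k (by omega) (by omega)

theorem IsLocal.isCellularAutomaton {r : ℕ} {F : X.carrier → X.carrier} (hF : IsLocal r F) :
    IsCellularAutomaton X F := by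
  classical
  refine ⟨-r, r, by omega, fun w =>
    if h : ∃ p : X.carrier × ℤ, ∀ k : Set.Icc (-(r : ℤ)) r, p.1.1 (p.2 + k) = w k then
      (F h.choose.1).1 h.choose.2
    else w ⟨0, by simp⟩, fun x i => ?_⟩
  have h : ∃ p : X.carrier × ℤ, ∀ k : Set.Icc (-(r : ℤ)) r, p.1.1 (p.2 + k) = x.1 (i + k) :=
    ⟨(x, i), fun _ => rfl⟩
  beta_reduce
  rw [dif_pos h]
  exact hF _ _ _ _ fun k h1 h2 => (h.choose_spec ⟨k, h1, h2⟩).symm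

theorem shiftPerm_apply (g : ℤ) (x : X.carrier) (i : ℤ) :
    (shiftPerm X g x).1 i = x.1 (g + i) := rfl

theorem IsLocal.apply_shiftPerm {r : ℕ} {F : X.carrier → X.carrier} (hF : IsLocal r F)
    (g : ℤ) (x : X.carrier) (i : ℤ) : (F (shiftPerm X g x)).1 i = (F x).1 (g + i) :=
  hF _ _ _ _ fun k _ _ => by rw [shiftPerm_apply, add_assoc]

theorem IsLocal.shiftPerm_comp {r : ℕ} {F : X.carrier → X.carrier} (hF : IsLocal r F) (g : ℤ) :
    IsLocal (r + g.natAbs) (shiftPerm X g ∘ F) := by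
  intro x y i j h
  refine hF x y (g + i) (g + j) fun k h1 h2 => ?_
  have := h (g + k) (by omega) (by omega)
  rwa [show g + i + k = i + (g + k) by ring, show g + j + k = j + (g + k) by ring]

end Local

/-! ### Extreme zeros and the seam between two half-points -/

/-- The point `l` is the last zero of `x`. -/
structure LastZero (x : ℤ → Fin 2) (l : ℤ) : Prop where
  zero : x l = 0
  ones : ∀ i, l < i → x i = 1

/-- The point `l` is the first zero of `x`. -/
structure FirstZero (x : ℤ → Fin 2) (l : ℤ) : Prop where
  zero : x l = 0
  ones : ∀ i, i < l → x i = 1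

theorem LastZero.unique {x : ℤ → Fin 2} {l m : ℤ} (hl : LastZero x l) (hm : LastZero x m) :
    l = m := by
  have := hl.zero
  have := hm.zero
  rcases lt_trichotomy l m with h | h | h
  · have := hl.ones m h; omega
  · exact h
  · have := hm.ones l h; omega

theorem exists_lastZero {x : ℤ → Fin 2} {c i : ℤ} (hc : ∀ j, c < j → x j = 1) (hi : x i ≠ 1) :
    ∃ l, LastZero x l := by
  obtain ⟨l, h1, h2⟩ := Int.exists_greatest_of_bdd (P := fun j => x j ≠ 1)
    ⟨c, fun j hj => not_lt.1 fun h => hj (hc j h)⟩ ⟨i, hi⟩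
  refine ⟨l, by omega, fun j hj => ?_⟩
  by_contra h
  exact absurd (h2 j h) (not_le.2 hj)

theorem exists_firstZero {x : ℤ → Fin 2} {c i : ℤ} (hc : ∀ j, j < c → x j = 1) (hi : x i ≠ 1) :
    ∃ l, FirstZero x l := by
  obtain ⟨l, h1, h2⟩ := Int.exists_least_of_bdd (P := fun j => x j ≠ 1)
    ⟨c, fun j hj => not_lt.1 fun h => hj (hc j h)⟩ ⟨i, hi⟩
  refine ⟨l, by omega, fun j hj => ?_⟩
  by_contra h
  exact absurd (h2 j h) (not_le.2 hj)

section Seam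

variable {X : Subshift (Fin 2) ℤ} {F : X.carrier → X.carrier} {r : ℕ}

/-- If points `z` look like `u` to the left and like a far right translate of `v` to the right,
then the last zero of `F u` and the translated first zero of `F v` form a gap of `F z`. -/
theorem IsLocal.exists_isGap (hF : IsLocal r F) {u v : X.carrier} {l ρ : ℤ}
    (hl : LastZero (F u).1 l) (hρ : FirstZero (F v).1 ρ) (c d : ℤ) :
    ∃ M : ℤ, ∀ m ≥ M, ∀ z : X.carrier, (∀ i < m + d, z.1 i = u.1 i) →
      (∀ i > c, z.1 i = v.1 (i - m)) → IsGap (F z).1 l (m + ρ) := by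
  -- The four bounds ensure that `F z` agrees with `F u` at `l`, that it agrees with the translate
  -- of `F v` at `m + ρ`, that the two ranges of agreement cover all positions in between, and that
  -- `l < m + ρ`.
  refine ⟨max (max (l + r - d + 1) (c + r - ρ + 1)) (max (c + 2 * r - d + 2) (l - ρ + 1)),
    fun m hm z hu hv => ?_⟩
  have h1 : ∀ i, i + r < m + d → (F z).1 i = (F u).1 i := fun i hi =>
    hF.congr fun k _ _ => hu k (by omega)
  have h2 : ∀ i, c < i - r → (F z).1 i = (F v).1 (i - m) := fun i hi =>
    hF.congr_shift fun k _ _ => hv k (by omega)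
  refine ⟨by omega, ?_, ?_, fun k hk1 hk2 => ?_⟩
  · rw [h1 l (by omega), hl.zero]
  · rw [h2 _ (by omega), add_sub_cancel_left, hρ.zero]
  · by_cases hk : k + r < m + d
    · rw [h1 k hk, hl.ones k hk1]
    · rw [h2 k (by omega), hρ.ones _ (by omega)]

end Seam

/-! ### Gluing and restricting points; displacement of extreme zeros -/

section GapShift

variable {S : Set ℕ}

/-- The sequence that agrees with `x` up to `c`, with `y` from `d` on, and is `1` in between. -/
def glue (x y : ℤ → Fin 2) (c d : ℤ) (t : ℤ) : Fin 2 :=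
  if t ≤ c then x t else if d ≤ t then y t else 1

theorem ones_mem (hS : S.Infinite) : (fun _ => 1) ∈ (gapShift S).carrier :=
  (mem_gapShift_iff hS).2 fun i j h => absurd h.left (by simp)

/-- The point of the gap shift that is constantly `1`. -/
def onesPoint (hS : S.Infinite) : (gapShift S).carrier := ⟨fun _ => 1, ones_mem hS⟩

theorem glue_mem (hS : S.Infinite) {x y : ℤ → Fin 2} (hx : x ∈ (gapShift S).carrier)
    (hy : y ∈ (gapShift S).carrier) {c d : ℤ} (hxc : x c = 0) (hyd : y d = 0)
    (h : ∃ n ∈ S, d = c + (n : ℤ) + 1) : glue x y c d ∈ (gapShift S).carrier := by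
  rw [mem_gapShift_iff hS] at hx hy ⊢
  intro i j hij
  have hcd : c < d := by obtain ⟨n, -, h⟩ := h; omega
  have hc : glue x y c d c = 0 := by simp [glue, hxc]
  have hd : glue x y c d d = 0 := by simp [glue, hyd, not_le.2 hcd]
  have e1 : ∀ t ≤ c, glue x y c d t = x t := fun t ht => by simp [glue, ht]
  have e2 : ∀ t ≥ d, glue x y c d t = y t := fun t ht => by
    simp [glue, ht, show ¬ t ≤ c by omega]
  have e3 : ∀ t, c < t → t < d → glue x y c d t = 1 := fun t h1 h2 => by
    simp [glue, not_le.2 h1, not_le.2 h2]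
  obtain ⟨hlt, hi, hj, hones⟩ := hij
  by_cases hjc : j ≤ c
  · refine hx i j ⟨hlt, by rw [← e1 i (by omega), hi], by rw [← e1 j hjc, hj], fun k h1 h2 => ?_⟩
    rw [← e1 k (by omega), hones k h1 h2]
  · by_cases hid : d ≤ i
    · refine hy i j ⟨hlt, by rw [← e2 i hid, hi], by rw [← e2 j (by omega), hj],
        fun k h1 h2 => ?_⟩
      rw [← e2 k (by omega), hones k h1 h2]
    · have hic : i ≤ c := by
        by_contra hne
        have := e3 i (by omega) (by omega)
        omega
      have hdj : d ≤ j := by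
        by_contra hne
        have := e3 j (by omega) (by omega)
        omega
      have h1 : i = c := by
        by_contra hne
        have := hones c (by omega) (by omega)
        omega
      have h2 : j = d := by
        by_contra hne
        have := hones d (by omega) (by omega)
        omega
      rwa [h1, h2]

theorem restrict_mem (hS : S.Infinite) {x : ℤ → Fin 2} (hx : x ∈ (gapShift S).carrier)
    {I : Set ℤ} [DecidablePred (· ∈ I)] (hI : I.OrdConnected) :
    (fun t => if t ∈ I then x t else 1) ∈ (gapShift S).carrier := by
  rw [mem_gapShift_iff hS] at hx ⊢
  intro i j hij
  have hi : i ∈ I := by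
    by_contra h
    have := hij.left
    simp [h] at this
  have hj : j ∈ I := by
    by_contra h
    have := hij.right
    simp [h] at this
  refine hx i j ⟨hij.lt, ?_, ?_, fun k h1 h2 => ?_⟩
  · simpa [hi] using hij.left
  · simpa [hj] using hij.right
  · have := hij.ones k h1 h2
    rwa [if_pos (hI.out hi hj ⟨h1.le, h2.le⟩)] at this

/-- The restriction of a point of the gap shift to an interval, filled up with `1`s. -/
def restrictPoint (hS : S.Infinite) (x : (gapShift S).carrier) (I : Set ℤ)
    [DecidablePred (· ∈ I)] (hI : I.OrdConnected) : (gapShift S).carrier :=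
  ⟨fun t => if t ∈ I then x.1 t else 1, restrict_mem hS x.2 hI⟩

theorem restrictPoint_of_mem (hS : S.Infinite) (x : (gapShift S).carrier) {I : Set ℤ}
    [DecidablePred (· ∈ I)] (hI : I.OrdConnected) {t : ℤ} (ht : t ∈ I) :
    (restrictPoint hS x I hI).1 t = x.1 t := if_pos ht

theorem restrictPoint_of_notMem (hS : S.Infinite) (x : (gapShift S).carrier) {I : Set ℤ}
    [DecidablePred (· ∈ I)] (hI : I.OrdConnected) {t : ℤ} (ht : t ∉ I) :
    (restrictPoint hS x I hI).1 t = 1 := if_neg ht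

/-- The sequence with a single zero, at the origin, belongs to the gap shift. -/
theorem single_mem (hS : S.Infinite) :
    (fun t : ℤ => if t = 0 then (0 : Fin 2) else 1) ∈ (gapShift S).carrier := by
  rw [mem_gapShift_iff hS]
  intro i j hij
  have h1 : i = 0 := by by_contra h; have := hij.left; simp [h] at this
  have h2 : j = 0 := by by_contra h; have := hij.right; simp [h] at this
  have := hij.lt
  omega

/-- The point of the gap shift with a single zero, at the origin. -/
def singlePoint (hS : S.Infinite) : (gapShift S).carrier := ⟨_, single_mem hS⟩

theorem lastZero_singlePoint (hS : S.Infinite) : LastZero (singlePoint hS).1 0 :=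
  ⟨by simp [singlePoint], fun _ h => if_neg h.ne'⟩

theorem firstZero_singlePoint (hS : S.Infinite) : FirstZero (singlePoint hS).1 0 :=
  ⟨by simp [singlePoint], fun _ h => if_neg h.ne⟩

variable {F : (gapShift S).carrier → (gapShift S).carrier} {r : ℕ}

/-- A large gap of length in `S` between the last zero of `u` and the first zero of a translate of
`v` is mapped to a gap between the last zero of `F u` and the first zero of the translate of
`F v`. -/
theorem IsLocal.exists_gap_mem (hS : S.Infinite) (hF : IsLocal r F) {u v : (gapShift S).carrier}
    {c d l ρ : ℤ} (hc : LastZero u.1 c) (hd : FirstZero v.1 d) (hl : LastZero (F u).1 l)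
    (hρ : FirstZero (F v).1 ρ) :
    ∃ M : ℤ, ∀ m ≥ M, (∃ n ∈ S, m + d = c + (n : ℤ) + 1) → ∃ n ∈ S, m + ρ = l + (n : ℤ) + 1 := by
  obtain ⟨M, hM⟩ := hF.exists_isGap hl hρ c d
  refine ⟨M, fun m hm hn => ?_⟩
  have hcd : c < m + d := by obtain ⟨n, -, h⟩ := hn; omega
  have hv : (shiftPerm _ (-m) v).1 (m + d) = 0 := by
    rw [shiftPerm_apply, neg_add_cancel_left, hd.zero]
  have hz := glue_mem hS u.2 (shiftPerm _ (-m) v).2 hc.zero hv hn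
  have hg := hM m hm ⟨_, hz⟩ (fun i hi => ?_) (fun i hi => ?_)
  · exact (mem_gapShift_iff hS).1 (F ⟨_, hz⟩).2 _ _ hg
  · simp only [glue, not_le.2 hi, if_false]
    split_ifs with h
    · rfl
    · exact (hc.ones i (not_le.1 h)).symm
  · simp only [glue, not_le.2 hi, if_false, shiftPerm_apply]
    rw [show -m + i = i - m by ring]
    split_ifs with h
    · rfl
    · exact (hd.ones _ (by omega)).symm

theorem IsLocal.apply_onesPoint (hS : S.Infinite) (hF : IsLocal r F) (i j : ℤ) :
    (F (onesPoint hS)).1 i = (F (onesPoint hS)).1 j := hF _ _ _ _ fun _ _ _ => rfl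

/-- A long finite block of zeros surrounded by 1s has an image that is 0 far out and 1 deep inside
the block, hence a gap. Varying the length of the block by one varies the gap by one, so every large
length occurs in `S`. -/
theorem IsLocal.eventually_const_of_zeros (hS : S.Infinite) (hF : IsLocal r F)
    {z : (gapShift S).carrier} (hz : ∀ i, z.1 i = 0) (h1 : ∀ i, (F z).1 i = 1)
    (h0 : ∀ i, (F (onesPoint hS)).1 i = 0) : ∃ N : ℕ, ∀ n ≥ N, n ∈ S := by
  have h0S : 0 ∈ S := by
    obtain ⟨n, hn, h⟩ := (mem_gapShift_iff hS).1 z.2 0 1 ⟨by omega, hz 0, hz 1, fun k _ _ => by omega⟩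
    rwa [show 0 = n by omega]
  let u := restrictPoint hS z (Set.Ici 0) Set.ordConnected_Ici
  let v := restrictPoint hS z (Set.Iic 0) Set.ordConnected_Iic
  have hu0 : ∀ i, 0 ≤ i → u.1 i = 0 := fun i hi =>
    (restrictPoint_of_mem hS z _ (Set.mem_Ici.2 hi)).trans (hz i)
  have hu1 : ∀ i, i < 0 → u.1 i = 1 := fun i hi =>
    restrictPoint_of_notMem hS z _ (not_le.2 hi)
  have hv0 : ∀ i, i ≤ 0 → v.1 i = 0 := fun i hi =>
    (restrictPoint_of_mem hS z _ (Set.mem_Iic.2 hi)).trans (hz i)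
  have hv1 : ∀ i, 0 < i → v.1 i = 1 := fun i hi =>
    restrictPoint_of_notMem hS z _ (not_le.2 hi)
  obtain ⟨l, hl⟩ : ∃ l, LastZero (F u).1 l := by
    refine exists_lastZero (c := r) (i := -r - 1) (fun j hj => ?_) ?_
    · rw [← h1 j]
      exact hF.congr fun k _ _ => by rw [hu0 k (by omega), hz]
    · have : (F u).1 (-r - 1) = (F (onesPoint hS)).1 (-r - 1) :=
        hF.congr fun k _ _ => hu1 k (by omega)
      rw [this, h0]
      simp
  obtain ⟨ρ, hρ⟩ : ∃ ρ, FirstZero (F v).1 ρ := by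
    refine exists_firstZero (c := -r) (i := r + 1) (fun j hj => ?_) ?_
    · rw [← h1 j]
      exact hF.congr fun k _ _ => by rw [hv0 k (by omega), hz]
    · have : (F v).1 (r + 1) = (F (onesPoint hS)).1 (r + 1) :=
        hF.congr fun k _ _ => hv1 k (by omega)
      rw [this, h0]
      simp
  obtain ⟨M, hM⟩ := hF.exists_isGap hl hρ (-1) 1
  refine ⟨(M + ρ - l - 1).toNat, fun n hn => ?_⟩
  let m : ℤ := n + 1 + l - ρ
  have hg := hM m (by omega) (restrictPoint hS z (Set.Icc 0 m) Set.ordConnected_Icc)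
    (fun i hi => ?_) (fun i hi => ?_)
  · obtain ⟨n', hn', h⟩ := (mem_gapShift_iff hS).1 (F _).2 _ _ hg
    rwa [show n = n' by omega]
  · by_cases h : 0 ≤ i
    · rw [restrictPoint_of_mem hS z _ (Set.mem_Icc.2 ⟨h, by omega⟩), hu0 i h, hz]
    · rw [restrictPoint_of_notMem hS z _ fun h' => h h'.1, hu1 i (by omega)]
  · by_cases h : i ≤ m
    · rw [restrictPoint_of_mem hS z _ (Set.mem_Icc.2 ⟨by omega, h⟩), hv0 _ (by omega), hz]
    · rw [restrictPoint_of_notMem hS z _ fun h' => h h'.2, hv1 _ (by omega)]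

variable {F : Equiv.Perm (gapShift S).carrier}

/-- The image is constant. If it were all zeros, the inverse would map all zeros to all ones and, by
injectivity, all ones to all zeros; then `S` would be cofinite and the shift sofic. -/
theorem perm_apply_onesPoint (hS : S.Infinite) (hX : ¬ IsSofic (gapShift S)) {s : ℕ}
    (hF : IsLocal r F) (hF' : IsLocal s F.symm) : F (onesPoint hS) = onesPoint hS := by
  have h01 : (F (onesPoint hS)).1 0 = 0 ∨ (F (onesPoint hS)).1 0 = 1 := by omega
  rcases h01 with h | h
  · exfalso
    refine hX ?_
    have hE : ∀ i, (F.symm (onesPoint hS)).1 i = 0 := by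
      intro i
      by_contra hne
      have : F.symm (onesPoint hS) = onesPoint hS := by
        ext1
        funext j
        rw [hF'.apply_onesPoint hS j i]
        change _ = 1
        omega
      rw [Equiv.symm_apply_eq] at this
      rw [← this] at h
      exact absurd h (by simp [onesPoint])
    obtain ⟨N, hN⟩ := hF'.eventually_const_of_zeros hS (z := F (onesPoint hS))
      (fun i => by rw [hF.apply_onesPoint hS i 0, h]) (fun i => by simp [onesPoint]) hE
    exact isSofic_of_eventually_periodic (N := N) (p := 1) hS.nonempty one_pos fun n hn =>
      iff_of_true (hN n hn) (hN _ (by omega))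
  · ext1
    funext j
    rw [hF.apply_onesPoint hS j 0, h]
    simp [onesPoint]

/-- Far to the right the image looks like that of the all-ones point, which is fixed; by injectivity
it is not the all-ones point itself. -/
theorem IsLocal.exists_lastZero (hS : S.Infinite) (hF : IsLocal r F)
    (h1 : F (onesPoint hS) = onesPoint hS) {u : (gapShift S).carrier} {c : ℤ}
    (hu : LastZero u.1 c) : ∃ l, LastZero (F u).1 l := by
  have hne : F u ≠ onesPoint hS := by
    rw [← h1, F.injective.ne_iff]
    rintro rfl
    exact absurd hu.zero (by simp [onesPoint])
  obtain ⟨i, hi⟩ : ∃ i, (F u).1 i ≠ 1 := by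
    by_contra! h
    exact hne (Subtype.ext (funext h))
  refine SymbolicShift.exists_lastZero (c := c + r) (fun j hj => ?_) hi
  have : (F u).1 j = (F (onesPoint hS)).1 j := hF.congr fun k _ _ => hu.ones k (by omega)
  rw [this, h1]
  rfl

theorem IsLocal.exists_firstZero (hS : S.Infinite) (hF : IsLocal r F)
    (h1 : F (onesPoint hS) = onesPoint hS) {u : (gapShift S).carrier} {c : ℤ}
    (hu : FirstZero u.1 c) : ∃ l, FirstZero (F u).1 l := by
  have hne : F u ≠ onesPoint hS := by
    rw [← h1, F.injective.ne_iff]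
    rintro rfl
    exact absurd hu.zero (by simp [onesPoint])
  obtain ⟨i, hi⟩ : ∃ i, (F u).1 i ≠ 1 := by
    by_contra! h
    exact hne (Subtype.ext (funext h))
  refine SymbolicShift.exists_firstZero (c := c - r) (fun j hj => ?_) hi
  have : (F u).1 j = (F (onesPoint hS)).1 j := hF.congr fun k _ _ => hu.ones k (by omega)
  rw [this, h1]
  rfl

/-- If the gap shift is not sofic, an automorphism displaces all last zeros and all first zeros by
the same amount. -/
theorem displacement_eq (hS : S.Infinite) (hX : ¬ IsSofic (gapShift S)) {s : ℕ}
    (hF : IsLocal r F) (hF' : IsLocal s F.symm) {u v : (gapShift S).carrier} {c d l ρ : ℤ}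
    (hc : LastZero u.1 c) (hd : FirstZero v.1 d) (hl : LastZero (F u).1 l)
    (hρ : FirstZero (F v).1 ρ) : ρ - d = l - c := by
  by_contra hne
  obtain ⟨M, hM⟩ := hF.exists_gap_mem hS hc hd hl hρ
  obtain ⟨M', hM'⟩ := hF'.exists_gap_mem hS hl hρ (l := c) (ρ := d)
    (by rwa [Equiv.symm_apply_apply]) (by rwa [Equiv.symm_apply_apply])
  -- Join `u` and a translate of `v` by a gap of length `n`: `F` turns it into one of length `n'`,
  -- and the inverse of `F` turns it back. A nonzero difference of displacements would thus be an
  -- eventual period of `S`.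
  have key : ∀ n : ℕ, max M M' + d - c ≤ n → ∀ n' : ℕ,
      (n' : ℤ) = n + (ρ - d) - (l - c) → (n ∈ S ↔ n' ∈ S) := by
    intro n hn n' hn'
    constructor
    · intro h
      obtain ⟨k, hk, hk'⟩ := hM (c + n + 1 - d) (by omega) ⟨n, h, by omega⟩
      rwa [show n' = k by omega]
    · intro h
      obtain ⟨k, hk, hk'⟩ := hM' (c + n + 1 - d) (by omega) ⟨n', h, by omega⟩
      rwa [show n = k by omega]
  refine hX (isSofic_of_eventually_periodic
    (N := (max M M' + d - c).toNat + (l - c - (ρ - d)).toNat)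
    (p := ((ρ - d) - (l - c)).natAbs) hS.nonempty (by omega) fun n hn => ?_)
  rcases lt_or_gt_of_ne hne with h | h
  · exact (key (n + ((ρ - d) - (l - c)).natAbs) (by omega) n (by omega)).symm
  · exact key n (by omega) _ (by omega)

/-- If the gap shift is not sofic, an automorphism displaces all last zeros and all first zeros by
a constant. -/
theorem exists_displacement (hS : S.Infinite) (hX : ¬ IsSofic (gapShift S)) {s : ℕ}
    (hF : IsLocal r F) (hF' : IsLocal s F.symm) :
    ∃ k : ℤ, ∀ (u : (gapShift S).carrier) (c : ℤ),
      (LastZero u.1 c → LastZero (F u).1 (c + k)) ∧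
        (FirstZero u.1 c → FirstZero (F u).1 (c + k)) := by
  have h1 := perm_apply_onesPoint hS hX hF hF'
  obtain ⟨l, hl⟩ := hF.exists_lastZero hS h1 (lastZero_singlePoint hS)
  obtain ⟨ρ, hρ⟩ := hF.exists_firstZero hS h1 (firstZero_singlePoint hS)
  have h2 := displacement_eq hS hX hF hF' (lastZero_singlePoint hS) (firstZero_singlePoint hS)
    hl hρ
  -- Every last zero is compared with the first zero of the single-zero point and every first zero
  -- with its last zero, so one constant serves for both.
  refine ⟨l, fun u c => ⟨fun hu => ?_, fun hu => ?_⟩⟩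
  · obtain ⟨l', hl'⟩ := hF.exists_lastZero hS h1 hu
    have h3 := displacement_eq hS hX hF hF' hu (firstZero_singlePoint hS) hl' hρ
    rwa [show c + l = l' by omega]
  · obtain ⟨ρ', hρ'⟩ := hF.exists_firstZero hS h1 hu
    have h3 := displacement_eq hS hX hF hF' (lastZero_singlePoint hS) hu hl hρ'
    rwa [show c + l = ρ' by omega]

/-- Cut `x` inside the gap into a point with last zero `i` and one with first zero `j`. The bound on
`j - i` places both displaced zeros where `F x` agrees with the image of the matching half, and
makes the two ranges of agreement overlap. -/
theorem IsLocal.isGap_apply (hS : S.Infinite) (hF : IsLocal r F) {k : ℤ}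
    (hk : ∀ (u : (gapShift S).carrier) (c : ℤ), (LastZero u.1 c → LastZero (F u).1 (c + k)) ∧
        (FirstZero u.1 c → FirstZero (F u).1 (c + k))) {x : (gapShift S).carrier} {i j : ℤ}
    (hij : 2 * r + k.natAbs < j - i) (h : IsGap x.1 i j) :
    IsGap (F x).1 (i + k) (j + k) := by
  let u := restrictPoint hS x (Set.Iic i) Set.ordConnected_Iic
  let v := restrictPoint hS x (Set.Ici j) Set.ordConnected_Ici
  have hu : ∀ t < j, x.1 t = u.1 t := fun t ht => by
    by_cases hti : t ≤ i
    · exact (restrictPoint_of_mem hS x _ (Set.mem_Iic.2 hti)).symm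
    · rw [restrictPoint_of_notMem hS x _ (Set.notMem_Iic.2 (not_le.1 hti)), h.ones t (by omega) ht]
  have hv : ∀ t > i, x.1 t = v.1 t := fun t ht => by
    by_cases htj : j ≤ t
    · exact (restrictPoint_of_mem hS x _ (Set.mem_Ici.2 htj)).symm
    · rw [restrictPoint_of_notMem hS x _ (Set.notMem_Ici.2 (not_le.1 htj)), h.ones t ht (by omega)]
  have hlu : LastZero (F u).1 (i + k) := (hk u i).1
    ⟨(hu i h.lt).symm.trans h.left, fun t ht => restrictPoint_of_notMem hS x _ (not_le.2 ht)⟩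
  have hfv : FirstZero (F v).1 (j + k) := (hk v j).2
    ⟨(hv j h.lt).symm.trans h.right, fun t ht => restrictPoint_of_notMem hS x _ (not_le.2 ht)⟩
  have e1 : ∀ t, t + r < j → (F x).1 t = (F u).1 t := fun t ht =>
    hF.congr fun k _ _ => hu k (by omega)
  have e2 : ∀ t, i < t - r → (F x).1 t = (F v).1 t := fun t ht =>
    hF.congr fun k _ _ => hv k (by omega)
  refine ⟨by have := h.lt; omega, ?_, ?_, fun t h1 h2 => ?_⟩
  · rw [e1 _ (by omega), hlu.zero]
  · rw [e2 _ (by omega), hfv.zero]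
  · by_cases ht : t + r < j
    · rw [e1 t ht, hlu.ones t h1]
    · rw [e2 t (by omega), hfv.ones t h2]

/-! ### Rigidity of automorphisms -/

/-- The map `F` has radius `N` and preserves all gaps longer than `N`. -/
structure IsRigid (hS : S.Infinite) (N : ℕ) (F : Equiv.Perm (gapShift S).carrier) : Prop where
  isLocal : IsLocal N F
  isGap_iff : ∀ (x : (gapShift S).carrier) (i j : ℤ), N < j - i →
    (IsGap (F x).1 i j ↔ IsGap x.1 i j)
  ones : F (onesPoint hS) = onesPoint hS

theorem IsRigid.mono (hS : S.Infinite) {M N : ℕ} (hF : IsRigid hS M F) (h : M ≤ N) :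
    IsRigid hS N F :=
  ⟨hF.isLocal.mono h, fun x i j hij => hF.isGap_iff x i j (by omega), hF.ones⟩

/-- If the gap shift is not sofic, every automorphism is rigid up to a shift. -/
theorem exists_isRigid (hS : S.Infinite) (hX : ¬ IsSofic (gapShift S))
    (hF : F ∈ Aut (gapShift S)) : ∃ (k : ℤ) (N : ℕ), IsRigid hS N (shiftPerm _ k * F) := by
  obtain ⟨r, hr⟩ := IsCellularAutomaton.exists_isLocal hF
  obtain ⟨s, hs⟩ : ∃ s, IsLocal s F.symm :=
    IsCellularAutomaton.exists_isLocal ((Aut (gapShift S)).inv_mem hF)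
  obtain ⟨k, hk⟩ := exists_displacement hS hX hr hs
  obtain ⟨k', hk'⟩ := exists_displacement (F := F.symm) hS hX hs hr
  -- The inverse displaces by `-k`, so it carries gaps of `F x` back to gaps of `x`; this yields the
  -- direction from `F x` to `x` below.
  have hkk : k + k' = 0 := by
    have h1 := (hk' _ _).1 ((hk _ _).1 (lastZero_singlePoint hS))
    rw [Equiv.symm_apply_apply] at h1
    have := h1.unique (lastZero_singlePoint hS)
    omega
  have hsh : ∀ (x : (gapShift S).carrier) (i j : ℤ),
      IsGap ((shiftPerm _ k * F : Equiv.Perm (gapShift S).carrier) x).1 i j ↔ IsGap (F x).1 (i + k) (j + k) := by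
    intro x i j
    have e : ∀ t, ((shiftPerm _ k * F : Equiv.Perm (gapShift S).carrier) x).1 t = (F x).1 (t + k) := fun t => by
      rw [add_comm]; rfl
    constructor
    · intro h
      refine ⟨by have := h.lt; omega, by rw [← e, h.left], by rw [← e, h.right],
        fun t h1 h2 => ?_⟩
      rw [show t = t - k + k by ring, ← e, h.ones _ (by omega) (by omega)]
    · intro h
      refine ⟨by have := h.lt; omega, by rw [e, h.left], by rw [e, h.right],
        fun t h1 h2 => ?_⟩
      rw [e, h.ones _ (by omega) (by omega)]
  refine ⟨k, 2 * r + 2 * s + k.natAbs, (hr.shiftPerm_comp k).mono (by omega),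
    fun x i j hij => ?_, ?_⟩
  · rw [hsh]
    constructor
    · intro h
      have := hs.isGap_apply hS hk' (by omega) h
      rwa [Equiv.symm_apply_apply, add_assoc, add_assoc, hkk, add_zero, add_zero] at this
    · exact hr.isGap_apply hS hk (by omega)
  · rw [Equiv.Perm.mul_apply, perm_apply_onesPoint hS hX hr hs]
    rfl

end GapShift

/-! ### Exchanging two neighbouring gaps -/

theorem IsGap.eq_of_overlap {x : ℤ → Fin 2} {i j i' j' : ℤ} (h : IsGap x i j)
    (h' : IsGap x i' j') (h1 : i < j') (h2 : i' < j) : i = i' ∧ j = j' := by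
  obtain ⟨-, a1, a2, a3⟩ := h
  obtain ⟨-, b1, b2, b3⟩ := h'
  refine ⟨?_, ?_⟩
  · rcases lt_trichotomy i i' with h | h | h
    · have := a3 i' h h2; omega
    · exact h
    · have := b3 i h h1; omega
  · rcases lt_trichotomy j j' with h | h | h
    · have := b3 j h2 h; omega
    · exact h
    · have := a3 j' h1 h; omega

theorem IsGap.congr {x y : ℤ → Fin 2} {i j i' j' : ℤ} (h : IsGap x i j) (hj : j - i = j' - i')
    (hxy : ∀ k, 0 ≤ k → k ≤ j - i → x (i + k) = y (i' + k)) : IsGap y i' j' := by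
  have hlt := h.lt
  refine ⟨by omega, ?_, ?_, fun k h1 h2 => ?_⟩
  · simpa [h.left] using (hxy 0 le_rfl (by omega)).symm
  · have := hxy (j - i) (by omega) le_rfl
    rw [show i + (j - i) = j by ring, show i' + (j - i) = j' by omega, h.right] at this
    exact this.symm
  · have := hxy (k - i') (by omega) (by omega)
    rw [h.ones _ (by omega) (by omega), show i' + (k - i') = k by ring] at this
    exact this.symm

/-- The word `0 1ᶜ 0 1ᵃ 0 1ᵇ W` with `W` of length `h + 1` occurs in `x` at `t`,
where `W` starts with `0`. -/
structure Occurs (a b c h : ℕ) (W x : ℤ → Fin 2) (t : ℤ) : Prop where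
  gap₀ : IsGap x t (t + c + 1)
  gap₁ : IsGap x (t + c + 1) (t + c + a + 2)
  gap₂ : IsGap x (t + c + a + 2) (t + c + a + b + 3)
  tail : ∀ k : ℤ, 0 ≤ k → k ≤ h → x (t + c + a + b + 3 + k) = W k

section Swap

variable {a b c h : ℕ} {W x y : ℤ → Fin 2} {t s : ℤ}

theorem Occurs.congr (hx : Occurs a b c h W x t)
    (hxy : ∀ k : ℤ, 0 ≤ k → k ≤ c + a + b + 3 + h → x (t + k) = y (s + k)) :
    Occurs a b c h W y s := by
  have key : ∀ p q : ℤ, t ≤ p → q ≤ t + c + a + b + 3 → IsGap x p q →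
      IsGap y (p + (s - t)) (q + (s - t)) := fun p q hp hq hg => by
    refine hg.congr (by ring) fun k h1 h2 => ?_
    have := hxy (p - t + k) (by omega) (by omega)
    rwa [show t + (p - t + k) = p + k by ring,
      show s + (p - t + k) = p + (s - t) + k by ring] at this
  have e0 := key _ _ (by omega) (by omega) hx.gap₀
  have e1 := key _ _ (by omega) (by omega) hx.gap₁
  have e2 := key _ _ (by omega) (by omega) hx.gap₂
  refine ⟨?_, ?_, ?_, fun k h1 h2 => ?_⟩
  · convert e0 using 1 <;> ring
  · convert e1 using 1 <;> ring
  · convert e2 using 1 <;> ring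
  · rw [← hx.tail k h1 h2]
    have := hxy (c + a + b + 3 + k) (by omega) (by omega)
    rw [show t + c + a + b + 3 + k = t + (c + a + b + 3 + k) by ring, this]
    congr 1
    ring

theorem Occurs.eq_of_mem (hx : Occurs a b c h W x t) (hy : Occurs a b c h W y t) {j : ℤ}
    (h1 : t ≤ j) (h2 : j ≤ t + c + a + b + 3) : x j = y j := by
  obtain rfl | rfl | rfl | rfl | h | h | h : j = t ∨ j = t + c + 1 ∨ j = t + c + a + 2 ∨
      j = t + c + a + b + 3 ∨ (t < j ∧ j < t + c + 1) ∨ (t + c + 1 < j ∧ j < t + c + a + 2) ∨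
      (t + c + a + 2 < j ∧ j < t + c + a + b + 3) := by omega
  · rw [hx.gap₀.left, hy.gap₀.left]
  · rw [hx.gap₁.left, hy.gap₁.left]
  · rw [hx.gap₂.left, hy.gap₂.left]
  · rw [hx.gap₂.right, hy.gap₂.right]
  · rw [hx.gap₀.ones j h.1 h.2, hy.gap₀.ones j h.1 h.2]
  · rw [hx.gap₁.ones j h.1 h.2, hy.gap₁.ones j h.1 h.2]
  · rw [hx.gap₂.ones j h.1 h.2, hy.gap₂.ones j h.1 h.2]

variable (a b c h W x t) in
/-- One of the words `0 1ᶜ 0 1ᵃ 0 1ᵇ W` and `0 1ᶜ 0 1ᵇ 0 1ᵃ W` occurs in `x` at `t`. -/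
def Marked : Prop := Occurs a b c h W x t ∨ Occurs b a c h W x t

variable (a b c h W x t) in
/-- The position `t` is the inner zero of `0 1ᵃ 0 1ᵇ 0` or of `0 1ᵇ 0 1ᵃ 0` in an occurrence
in `x` of one of the two words that are to be exchanged. -/
def IsFlip : Prop := ∃ s, Marked a b c h W x s ∧ (t = s + c + a + 2 ∨ t = s + c + b + 2)

open Classical in
variable (a b c h W x t) in
/-- The map that exchanges the words `0 1ᶜ 0 1ᵃ 0 1ᵇ W` and `0 1ᶜ 0 1ᵇ 0 1ᵃ W`. -/
noncomputable def gapSwap : Fin 2 := if IsFlip a b c h W x t then 1 - x t else x t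

theorem marked_comm : Marked a b c h W x t ↔ Marked b a c h W x t := or_comm

theorem isFlip_comm : IsFlip a b c h W x t ↔ IsFlip b a c h W x t := by
  simp only [IsFlip, marked_comm (a := a), or_comm (a := t = _ + c + a + 2)]

theorem gapSwap_comm : gapSwap a b c h W x = gapSwap b a c h W x := by
  classical
  funext t
  exact if_congr isFlip_comm rfl rfl

theorem gapSwap_of_not_isFlip (ht : ¬ IsFlip a b c h W x t) : gapSwap a b c h W x t = x t :=
  if_neg ht

theorem gapSwap_of_isFlip (ht : IsFlip a b c h W x t) : gapSwap a b c h W x t = 1 - x t :=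
  if_pos ht

theorem Marked.gap₀ (hx : Marked a b c h W x t) : IsGap x t (t + c + 1) :=
  hx.elim (·.gap₀) (·.gap₀)

theorem Marked.zero_end (hx : Marked a b c h W x t) : x (t + c + a + b + 3) = 0 := by
  rcases hx with hx | hx
  · exact hx.gap₂.right
  · rw [add_right_comm _ (a : ℤ)]
    exact hx.gap₂.right

theorem Marked.congr (hx : Marked a b c h W x t)
    (hxy : ∀ k : ℤ, 0 ≤ k → k ≤ c + a + b + 3 + h → x (t + k) = y (s + k)) :
    Marked a b c h W y s :=
  hx.imp (·.congr hxy) (·.congr fun k h1 h2 => hxy k h1 (by omega))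

theorem IsFlip.congr (hx : IsFlip a b c h W x t)
    (hxy : ∀ k : ℤ, -((c + a + b + 3 + h : ℕ) : ℤ) ≤ k → k ≤ (c + a + b + 3 + h : ℕ) →
      x (t + k) = y (s + k)) : IsFlip a b c h W y s := by
  obtain ⟨p, hp, hpt⟩ := hx
  refine ⟨p + (s - t), hp.congr fun k h1 h2 => ?_, by omega⟩
  have := hxy (p - t + k) (by push_cast; omega) (by push_cast; omega)
  rwa [show t + (p - t + k) = p + k by ring,
    show s + (p - t + k) = p + (s - t) + k by ring] at this

/-- The run `1ᶜ` is longer than everything between it and the end of the second exchanged gap. A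
later occurrence starting before that end would have the final zero of the first one inside its own
run `1ᶜ`. -/
theorem Marked.add_le (hc : a + b + h + 2 ≤ c) (hx : Marked a b c h W x t)
    (hy : Marked a b c h W x s) (hts : t < s) : t + c + a + b + 3 ≤ s := by
  have h1 := hx.zero_end
  have h2 := hy.gap₀.ones (t + c + a + b + 3)
  have h3 := hx.gap₀.ones s hts
  have h4 := hy.gap₀.left
  by_contra hlt
  have h5 : ¬ s < t + c + 1 := fun h5 => by have := h3 h5; omega
  have := h2 (by omega) (by omega)
  omega

/-- Since `c` also exceeds `h`, the exchange in one occurrence never touches another occurrence, not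
even its tail `W`. This makes simultaneous exchanges independent. -/
theorem Marked.eq_of_isFlip (hc : a + b + h + 2 ≤ c) (hx : Marked a b c h W x t)
    (hy : Marked a b c h W x s) {j : ℤ} (hj : j = s + c + a + 2 ∨ j = s + c + b + 2)
    (h1 : t ≤ j) (h2 : j ≤ t + c + a + b + 3 + h) : s = t := by
  rcases lt_trichotomy t s with hts | hts | hts
  · have := hx.add_le hc hy hts; omega
  · exact hts.symm
  · have := hy.add_le hc hx hts; omega

/-- Turning `1ᵃ 0 1ᵇ` into `1ᵇ 0 1ᵃ` changes just the two flip positions, which are distinct because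
`a ≠ b`; nothing else in the occurrence is flipped. -/
theorem Occurs.gapSwap (hab : a ≠ b) (hc : a + b + h + 2 ≤ c) (hx : Occurs a b c h W x t) :
    Occurs b a c h W (gapSwap a b c h W x) t := by
  have hm : Marked a b c h W x t := .inl hx
  have hz : SymbolicShift.gapSwap a b c h W x (t + c + b + 2) = 0 := by
    rw [gapSwap_of_isFlip ⟨t, hm, .inr rfl⟩]
    have : x (t + c + b + 2) = 1 := by
      rcases lt_or_gt_of_ne hab with h | h
      · exact hx.gap₂.ones _ (by omega) (by omega)
      · exact hx.gap₁.ones _ (by omega) (by omega)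
    rw [this]
    rfl
  have ho : SymbolicShift.gapSwap a b c h W x (t + c + a + 2) = 1 := by
    rw [gapSwap_of_isFlip ⟨t, hm, .inl rfl⟩, hx.gap₁.right]
    rfl
  have he : ∀ j, t ≤ j → j ≤ t + c + a + b + 3 + h → j ≠ t + c + a + 2 → j ≠ t + c + b + 2 →
      SymbolicShift.gapSwap a b c h W x j = x j := by
    intro j h1 h2 h3 h4
    refine gapSwap_of_not_isFlip fun ⟨s, hs, hj⟩ => ?_
    have := hm.eq_of_isFlip hc hs hj h1 h2
    omega
  have hones : ∀ j, t + c + 1 < j → j < t + c + a + b + 3 → j ≠ t + c + b + 2 →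
      SymbolicShift.gapSwap a b c h W x j = 1 := by
    intro j h1 h2 h3
    by_cases h4 : j = t + c + a + 2
    · rw [h4, ho]
    · rw [he j (by omega) (by omega) h4 h3]
      by_cases h5 : j < t + c + a + 2
      · exact hx.gap₁.ones j h1 h5
      · exact hx.gap₂.ones j (by omega) h2
  refine ⟨⟨by omega, ?_, ?_, fun k h1 h2 => ?_⟩, ⟨by omega, ?_, hz, fun k h1 h2 => ?_⟩,
    ⟨by omega, hz, ?_, fun k h1 h2 => ?_⟩, fun k h1 h2 => ?_⟩
  · rw [he _ (by omega) (by omega) (by omega) (by omega), hx.gap₀.left]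
  · rw [he _ (by omega) (by omega) (by omega) (by omega), hx.gap₀.right]
  · rw [he _ (by omega) (by omega) (by omega) (by omega), hx.gap₀.ones k h1 h2]
  · rw [he _ (by omega) (by omega) (by omega) (by omega), hx.gap₀.right]
  · exact hones k h1 (by omega) (by omega)
  · rw [he _ (by omega) (by omega) (by omega) (by omega), add_right_comm _ (b : ℤ),
      hx.gap₂.right]
  · exact hones k (by omega) (by omega) (by omega)
  · rw [he _ (by omega) (by omega) (by omega) (by omega), add_right_comm _ (b : ℤ),
      hx.tail k h1 h2]

theorem Occurs.gapSwap' (hab : a ≠ b) (hc : a + b + h + 2 ≤ c) (hx : Occurs b a c h W x t) :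
    Occurs a b c h W (SymbolicShift.gapSwap a b c h W x) t := by
  rw [gapSwap_comm]
  exact hx.gapSwap hab.symm (by omega)

theorem Marked.gapSwap (hab : a ≠ b) (hc : a + b + h + 2 ≤ c) (hx : Marked a b c h W x t) :
    Marked a b c h W (gapSwap a b c h W x) t :=
  hx.elim (fun hx => .inr (hx.gapSwap hab hc)) (fun hx => .inl (hx.gapSwap' hab hc))

/-- No occurrence is created: a marked window of the new point either contains a flip, whose
occurrence must then be that very window, or is unchanged from `x`. -/
theorem marked_gapSwap_iff (hab : a ≠ b) (hc : a + b + h + 2 ≤ c) :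
    Marked a b c h W (gapSwap a b c h W x) t ↔ Marked a b c h W x t := by
  refine ⟨fun hm => ?_, (·.gapSwap hab hc)⟩
  by_cases hf : ∃ j, t ≤ j ∧ j ≤ t + c + a + b + 3 + h ∧ IsFlip a b c h W x j
  · obtain ⟨j, h1, h2, s, hs, hj⟩ := hf
    rwa [← hm.eq_of_isFlip hc (hs.gapSwap hab hc) hj h1 h2]
  · push Not at hf
    exact hm.congr fun k h1 h2 => gapSwap_of_not_isFlip (hf _ (by omega) (by omega))

theorem isFlip_gapSwap_iff (hab : a ≠ b) (hc : a + b + h + 2 ≤ c) :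
    IsFlip a b c h W (gapSwap a b c h W x) t ↔ IsFlip a b c h W x t := by
  simp only [IsFlip, marked_gapSwap_iff hab hc]

theorem gapSwap_gapSwap (hab : a ≠ b) (hc : a + b + h + 2 ≤ c) :
    gapSwap a b c h W (gapSwap a b c h W x) = x := by
  funext t
  by_cases ht : IsFlip a b c h W x t
  · rw [gapSwap_of_isFlip ((isFlip_gapSwap_iff hab hc).2 ht), gapSwap_of_isFlip ht,
      sub_sub_cancel]
  · rw [gapSwap_of_not_isFlip (mt (isFlip_gapSwap_iff hab hc).1 ht), gapSwap_of_not_isFlip ht]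

variable {S : Set ℕ}

theorem Occurs.gap_mem (ha : a ∈ S) (hb : b ∈ S) (hx : Occurs a b c h W x t) {i j p : ℤ}
    (hij : IsGap x i j) (h1 : i ≤ p) (h2 : p ≤ j) (h3 : t + c + 1 < p)
    (h4 : p < t + c + a + b + 3) : ∃ n ∈ S, j = i + (n : ℤ) + 1 := by
  by_cases hi : i < t + c + a + 2
  · obtain ⟨h5, h6⟩ := hij.eq_of_overlap hx.gap₁ hi (by omega)
    exact ⟨a, ha, by omega⟩
  · have := hij.lt
    obtain ⟨h5, h6⟩ := hij.eq_of_overlap hx.gap₂ (by omega) (by omega)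
    exact ⟨b, hb, by omega⟩

/-- A gap of the new point that meets a flip is one of the exchanged gaps, with length `a` or `b`;
any other gap was already present in `x`. -/
theorem gapSwap_mem (hS : S.Infinite) (hab : a ≠ b) (hc : a + b + h + 2 ≤ c) (ha : a ∈ S)
    (hb : b ∈ S) (hx : x ∈ (gapShift S).carrier) :
    gapSwap a b c h W x ∈ (gapShift S).carrier := by
  rw [mem_gapShift_iff hS] at hx ⊢
  intro i j hij
  by_cases hf : ∃ p, i ≤ p ∧ p ≤ j ∧ IsFlip a b c h W x p
  · obtain ⟨p, h1, h2, s, hs, hp⟩ := hf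
    rcases hs.gapSwap hab hc with hs | hs
    · exact hs.gap_mem ha hb hij h1 h2 (by omega) (by omega)
    · exact hs.gap_mem hb ha hij h1 h2 (by omega) (by omega)
  · push Not at hf
    exact hx i j (hij.congr rfl fun k h1 h2 =>
      gapSwap_of_not_isFlip (hf _ (by omega) (by omega)))

variable (a b c h W) in
/-- The permutation of the gap shift exchanging the words `0 1ᶜ 0 1ᵃ 0 1ᵇ W` and
`0 1ᶜ 0 1ᵇ 0 1ᵃ W`. -/
noncomputable def gapSwapPerm (hS : S.Infinite) (hab : a ≠ b) (hc : a + b + h + 2 ≤ c)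
    (ha : a ∈ S) (hb : b ∈ S) : Equiv.Perm (gapShift S).carrier where
  toFun x := ⟨gapSwap a b c h W x.1, gapSwap_mem hS hab hc ha hb x.2⟩
  invFun x := ⟨gapSwap a b c h W x.1, gapSwap_mem hS hab hc ha hb x.2⟩
  left_inv _ := Subtype.ext (gapSwap_gapSwap hab hc)
  right_inv _ := Subtype.ext (gapSwap_gapSwap hab hc)

theorem gapSwapPerm_mem_aut (hS : S.Infinite) (hab : a ≠ b) (hc : a + b + h + 2 ≤ c)
    (ha : a ∈ S) (hb : b ∈ S) : gapSwapPerm a b c h W hS hab hc ha hb ∈ Aut (gapShift S) := by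
  refine IsLocal.isCellularAutomaton (r := c + a + b + 3 + h) fun x y i j hxy => ?_
  have hf : IsFlip a b c h W x.1 i ↔ IsFlip a b c h W y.1 j :=
    ⟨fun hf => hf.congr hxy, fun hf => hf.congr fun k h1 h2 => (hxy k h1 h2).symm⟩
  have h0 := hxy 0 (by omega) (by omega)
  simp only [add_zero] at h0
  change gapSwap a b c h W x.1 i = gapSwap a b c h W y.1 j
  by_cases hi : IsFlip a b c h W x.1 i
  · rw [gapSwap_of_isFlip hi, gapSwap_of_isFlip (hf.1 hi), h0]
  · rw [gapSwap_of_not_isFlip hi, gapSwap_of_not_isFlip (mt hf.2 hi), h0]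

/-- The points of the gap shift that start with `0 1ᶜ 0 1ᵃ 0 1ᵇ` and continue with a given point
whose first zero is at the origin. -/
theorem exists_occurs (hS : S.Infinite) (ha : a ∈ S) (hb : b ∈ S) (hc : c ∈ S)
    (y : (gapShift S).carrier) (hy : FirstZero y.1 0) (h : ℕ) :
    ∃ x : (gapShift S).carrier, Occurs a b c h y.1 x.1 (-(c + a + b + 3)) ∧
      ∀ t, -(b : ℤ) ≤ t → x.1 t = y.1 t := by
  -- The point is built from right to left: gluing a translate of `singlePoint` in front of the
  -- current first zero adds one gap, and this is done for `b`, `a` and `c` in turn.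
  have step : ∀ (n : ℕ) (q : ℤ) (z : (gapShift S).carrier), n ∈ S → FirstZero z.1 q →
      ∃ z' : (gapShift S).carrier, FirstZero z'.1 (q - n - 1) ∧ IsGap z'.1 (q - n - 1) q ∧
        ∀ t, q - n - 1 < t → z'.1 t = z.1 t := by
    intro n q z hn hz
    let e := shiftPerm _ (-(q - n - 1)) (singlePoint hS)
    have he : FirstZero e.1 (q - n - 1) := by
      refine ⟨?_, fun i hi => ?_⟩
      · rw [shiftPerm_apply, neg_add_cancel]
        exact (firstZero_singlePoint hS).zero
      · exact (firstZero_singlePoint hS).ones _ (by omega)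
    have hmem := glue_mem hS e.2 z.2 he.zero hz.zero ⟨n, hn, by ring⟩
    have h1 : ∀ t, t ≤ q - n - 1 → glue e.1 z.1 (q - n - 1) q t = e.1 t := fun t ht => if_pos ht
    have h2 : ∀ t, q - n - 1 < t → glue e.1 z.1 (q - n - 1) q t = z.1 t := fun t ht => by
      simp only [glue, not_le.2 ht, if_false]
      split_ifs with h
      · rfl
      · exact (hz.ones t (not_le.1 h)).symm
    refine ⟨⟨_, hmem⟩, ⟨?_, fun i hi => ?_⟩, ⟨by omega, ?_, ?_, fun k hk1 hk2 => ?_⟩, h2⟩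
    · exact (h1 _ le_rfl).trans he.zero
    · exact (h1 i hi.le).trans (he.ones i hi)
    · exact (h1 _ le_rfl).trans he.zero
    · exact (h2 q (by omega)).trans hz.zero
    · exact (h2 k hk1).trans (hz.ones k hk2)
  obtain ⟨z₁, f1, g1, e1⟩ := step b 0 y hb hy
  obtain ⟨z₂, f2, g2, e2⟩ := step a _ z₁ ha f1
  obtain ⟨z₃, f3, g3, e3⟩ := step c _ z₂ hc f2
  have g1' : IsGap z₃.1 (0 - b - 1) 0 := g1.congr rfl fun k h1 h2 => by
    rw [e3 _ (by omega), e2 _ (by omega)]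
  have g2' : IsGap z₃.1 (0 - b - 1 - a - 1) (0 - b - 1) := g2.congr rfl fun k h1 h2 => by
    rw [e3 _ (by omega)]
  refine ⟨z₃, ⟨?_, ?_, ?_, fun k h1 h2 => ?_⟩, fun t ht => ?_⟩
  · convert g3 using 1 <;> ring
  · convert g2' using 1 <;> ring
  · convert g1' using 1 <;> ring
  · rw [e3 _ (by omega), e2 _ (by omega), e1 _ (by omega)]
    exact congrArg y.1 (by ring)
  · rw [e3 _ (by omega), e2 _ (by omega), e1 _ (by omega)]

end Swap

/-! ### No finite set of automorphisms has centralizer `⟨σ⟩` -/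

section Commute

variable {S : Set ℕ} {N a b c h : ℕ} {F : Equiv.Perm (gapShift S).carrier}

/-- With `h = 0` the tail is only the final zero, so an occurrence consists of three long gaps, and
these are preserved. -/
theorem IsRigid.occurs_apply_iff (hS : S.Infinite) (hF : IsRigid hS N F) (ha : N ≤ a)
    (hb : N ≤ b) (hc : N ≤ c) {W : ℤ → Fin 2} (hW : W 0 = 0) {x : (gapShift S).carrier} {t : ℤ} :
    Occurs a b c 0 W (F x).1 t ↔ Occurs a b c 0 W x.1 t := by
  have tail : ∀ y : ℤ → Fin 2, y (t + c + a + b + 3) = 0 →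
      ∀ k : ℤ, 0 ≤ k → k ≤ (0 : ℕ) → y (t + c + a + b + 3 + k) = W k := by
    intro y hy k h1 h2
    obtain rfl : k = 0 := by omega
    rw [add_zero, hy, hW]
  constructor
  · rintro ⟨g0, g1, g2, -⟩
    rw [hF.isGap_iff _ _ _ (by omega)] at g0 g1 g2
    exact ⟨g0, g1, g2, tail _ g2.right⟩
  · rintro ⟨g0, g1, g2, -⟩
    rw [← hF.isGap_iff _ _ _ (by omega)] at g0 g1 g2
    exact ⟨g0, g1, g2, tail _ g2.right⟩

/-- Exchanging two neighbouring long gaps commutes with rigid maps. -/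
theorem IsRigid.apply_gapSwapPerm (hS : S.Infinite) (hF : IsRigid hS N F) (hab : a ≠ b)
    (hc : a + b + 0 + 2 ≤ c) (haS : a ∈ S) (hbS : b ∈ S) (ha : N ≤ a) (hb : N ≤ b)
    {W : ℤ → Fin 2} (hW : W 0 = 0) (x : (gapShift S).carrier) :
    F (gapSwapPerm a b c 0 W hS hab hc haS hbS x) =
      gapSwapPerm a b c 0 W hS hab hc haS hbS (F x) := by
  set G := gapSwapPerm a b c 0 W hS hab hc haS hbS
  have hG : ∀ y : (gapShift S).carrier, (G y).1 = gapSwap a b c 0 W y.1 := fun _ => rfl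
  have hab' : ∀ {y : (gapShift S).carrier} {t : ℤ},
      Occurs a b c 0 W (F y).1 t ↔ Occurs a b c 0 W y.1 t :=
    hF.occurs_apply_iff hS ha hb (by omega) hW
  have hba' : ∀ {y : (gapShift S).carrier} {t : ℤ},
      Occurs b a c 0 W (F y).1 t ↔ Occurs b a c 0 W y.1 t :=
    hF.occurs_apply_iff hS hb ha (by omega) hW
  have hm : ∀ {t : ℤ}, Marked a b c 0 W (F x).1 t ↔ Marked a b c 0 W x.1 t :=
    or_congr hab' hba'
  ext1
  funext j
  -- Inside an exchanged pair both sides are determined by the long gaps there. Elsewhere every flip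
  -- is more than `N` away from `j`, as `a` and `b` are at least `N`, so locality suffices.
  by_cases hj : ∃ t, Marked a b c 0 W x.1 t ∧ t + c + 1 ≤ j ∧ j ≤ t + c + a + b + 3
  · obtain ⟨t, ht, h1, h2⟩ := hj
    rcases ht with ht | ht
    · exact (hba'.2 (ht.gapSwap hab hc : Occurs b a c 0 W (G x).1 t)).eq_of_mem
        ((hab'.2 ht).gapSwap hab hc) (by omega) (by omega)
    · exact (hab'.2 (ht.gapSwap' hab hc : Occurs a b c 0 W (G x).1 t)).eq_of_mem
        ((hba'.2 ht).gapSwap' hab hc) (by omega) (by omega)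
  · push Not at hj
    have h1 : ¬ IsFlip a b c 0 W (F x).1 j := by
      rintro ⟨t, ht, htj⟩
      have := hj t (hm.1 ht) (by omega)
      omega
    rw [hG (F x), gapSwap_of_not_isFlip h1]
    refine hF.isLocal.congr fun k h2 h3 => ?_
    rw [hG x]
    refine gapSwap_of_not_isFlip ?_
    rintro ⟨t, ht, htk⟩
    have := hj t ht (by omega)
    omega

/-- Shifts are central in the automorphism group. -/
theorem shiftPerm_mul_comm {A : Type*} [TopologicalSpace A] [DiscreteTopology A] [Finite A]
    (X : Subshift A ℤ) (k : ℤ) {G : Equiv.Perm X.carrier} (hG : G ∈ Aut X) :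
    shiftPerm X k * G = G * shiftPerm X k :=
  Equiv.ext fun x => (((isCellularAutomaton_iff X _).1 hG).2 k x).symm

theorem shiftPerm_add {A : Type*} [TopologicalSpace A] (X : Subshift A ℤ) (k l : ℤ) :
    shiftPerm X (k + l) = shiftPerm X k * shiftPerm X l := by
  ext x i
  change x.1 (k + l + i) = x.1 (l + (k + i))
  exact congrArg x.1 (by ring)

theorem shiftPerm_zero {A : Type*} [TopologicalSpace A] (X : Subshift A ℤ) :
    shiftPerm X 0 = 1 := by
  ext x i
  change x.1 (0 + i) = x.1 i
  rw [zero_add]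

theorem coe_shiftAut_zpow {A : Type*} [TopologicalSpace A] [DiscreteTopology A] [Finite A]
    (X : Subshift A ℤ) (k : ℤ) :
    ((shiftAut X ^ k : Aut X) : Equiv.Perm X.carrier) = shiftPerm X k := by
  have h1 : ((shiftAut X : Aut X) : Equiv.Perm X.carrier) = shiftPerm X 1 := rfl
  rw [Subgroup.coe_zpow, h1]
  induction k with
  | zero => rw [zpow_zero, shiftPerm_zero]
  | succ n ih => rw [zpow_add_one, ih, ← shiftPerm_add]
  | pred n ih =>
    rw [zpow_sub_one, ih, mul_inv_eq_iff_eq_mul, ← shiftPerm_add, sub_add_cancel]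

/-- The single-zero point contains no gap and is fixed, so the shift would be trivial; but a point
containing the word is moved. -/
theorem gapSwapPerm_ne_shiftPerm (hS : S.Infinite) (hab : a ≠ b) (hc : a + b + h + 2 ≤ c)
    (ha : a ∈ S) (hb : b ∈ S) (hcS : c ∈ S) (k : ℤ) :
    gapSwapPerm a b c h (singlePoint hS).1 hS hab hc ha hb ≠ shiftPerm _ k := by
  intro heq
  have h0 : gapSwap a b c h (singlePoint hS).1 (singlePoint hS).1 0 = 0 := by
    rw [gapSwap_of_not_isFlip, (lastZero_singlePoint hS).zero]
    rintro ⟨t, ht, -⟩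
    have h1 := ht.gap₀.left
    have h2 := ht.gap₀.right
    rcases lt_or_ge 0 t with h3 | h3
    · rw [(lastZero_singlePoint hS).ones t h3] at h1
      omega
    · rcases h3.eq_or_lt with rfl | h3
      · rw [(lastZero_singlePoint hS).ones _ (by omega)] at h2
        omega
      · rw [(firstZero_singlePoint hS).ones t h3] at h1
        omega
  have h1 : gapSwap a b c h (singlePoint hS).1 (singlePoint hS).1 0 = (singlePoint hS).1 (k + 0) :=
    congrArg (fun y => y.1 0) (DFunLike.congr_fun heq (singlePoint hS))
  obtain rfl : k = 0 := by
    by_contra hne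
    rw [h0, add_zero] at h1
    exact absurd h1.symm (by simp [singlePoint, hne])
  obtain ⟨x, hx, -⟩ := exists_occurs hS ha hb hcS (singlePoint hS) (firstZero_singlePoint hS) h
  have h2 := congrArg (fun y => y.1) (DFunLike.congr_fun heq x)
  have h3 : gapSwap a b c h (singlePoint hS).1 x.1 = x.1 := by
    rw [shiftPerm_zero] at h2
    exact h2
  have h4 := hx.gapSwap hab hc
  rw [h3] at h4
  have h5 := h4.gap₁.eq_of_overlap hx.gap₁ (by omega) (by omega)
  omega

theorem exists_swap_lengths (hS : S.Infinite) (N h : ℕ) :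
    ∃ a ∈ S, ∃ b ∈ S, ∃ c ∈ S, N ≤ a ∧ N ≤ b ∧ a ≠ b ∧ a + b + h + 2 ≤ c := by
  obtain ⟨a, ha, ha'⟩ := hS.exists_gt N
  obtain ⟨b, hb, hb'⟩ := hS.exists_gt a
  obtain ⟨c, hc, hc'⟩ := hS.exists_gt (a + b + h + 2)
  exact ⟨a, ha, b, hb, c, hc, ha'.le, by omega, hb'.ne, hc'.le⟩

/-- Finitely many automorphisms share a rigidity bound `M`. An exchange of gaps of lengths at least
`M` commutes with their rigid shifts, hence with the automorphisms themselves, as shifts are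
central. -/
theorem centralizer_ne_zpowers (hS : S.Infinite) (hX : ¬ IsSofic (gapShift S))
    {R : Set (Aut (gapShift S))} (hR : R.Finite) :
    Subgroup.centralizer R ≠ Subgroup.zpowers (shiftAut (gapShift S)) := by
  intro heq
  choose k N hN using fun F : Aut (gapShift S) => exists_isRigid hS hX F.2
  obtain ⟨M, hM⟩ := (hR.image N).bddAbove
  obtain ⟨a, ha, b, hb, c, hc, hMa, hMb, hab, habc⟩ := exists_swap_lengths hS M 0
  let G : Aut (gapShift S) :=
    ⟨gapSwapPerm a b c 0 (singlePoint hS).1 hS hab habc ha hb,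
      gapSwapPerm_mem_aut hS hab habc ha hb⟩
  have hG : G ∈ Subgroup.centralizer R := by
    rw [Subgroup.mem_centralizer_iff]
    intro F hF
    have hF' := (hN F).mono hS (hM ⟨F, hF, rfl⟩)
    have h1 : shiftPerm _ (k F) * F.1 * G.1 = G.1 * (shiftPerm _ (k F) * F.1) :=
      Equiv.ext fun x => hF'.apply_gapSwapPerm hS hab habc ha hb hMa hMb
        (lastZero_singlePoint hS).zero x
    rw [← mul_assoc, ← shiftPerm_mul_comm _ _ G.2, mul_assoc, mul_assoc] at h1
    exact Subtype.ext (mul_left_cancel h1)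
  rw [heq, Subgroup.mem_zpowers_iff] at hG
  obtain ⟨m, hm⟩ := hG
  have := congrArg Subtype.val hm
  rw [coe_shiftAut_zpow] at this
  exact gapSwapPerm_ne_shiftPerm hS hab habc ha hb hc m this.symm

end Commute

/-! ### The center of the automorphism group -/

section Center

variable {S : Set ℕ} {N : ℕ} {F : Equiv.Perm (gapShift S).carrier}

/-- A rigid automorphism that commutes with all automorphisms fixes each point whose first zero is
at the origin. -/
theorem IsRigid.apply_eq_of_firstZero (hS : S.Infinite) (hF : IsRigid hS N F)
    (hcomm : ∀ G ∈ Aut (gapShift S), F * G = G * F) {y : (gapShift S).carrier}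
    (hy : FirstZero y.1 0) {i : ℤ} (h1 : -(N : ℤ) ≤ i) : (F y).1 i = y.1 i := by
  by_contra hne
  -- Gaps of length at least `2 * N` make `x` agree with `y` on the `N`-neighbourhood of every `i ≥
  -- -N`. The tail length `i.toNat` lets the exchange test `y` up to position `i`.
  obtain ⟨a, ha, b, hb, c, hc, hNa, hNb, hab, habc⟩ := exists_swap_lengths hS (2 * N) i.toNat
  obtain ⟨x, hx, hxy⟩ := exists_occurs hS ha hb hc y hy i.toNat
  have hFx : (F x).1 i ≠ x.1 i := by
    rw [hxy i (by omega), hF.isLocal.congr (y := y) fun k _ _ => hxy k (by omega)]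
    exact hne
  set t : ℤ := -(c + a + b + 3) with ht
  have hgap : ∀ {z : (gapShift S).carrier} {p q : ℤ}, N < q - p → IsGap z.1 p q →
      IsGap (F z).1 p q := fun hpq hg => (hF.isGap_iff _ _ _ hpq).2 hg
  -- A negative `i` lies in the gap of length `b`, which `F` preserves, so both values would be 1.
  have hi : 0 ≤ i := by
    by_contra hi
    have g1 := hx.gap₂
    have g2 := hgap (by omega) hx.gap₂
    exact hFx (by rw [g1.ones i (by omega) (by omega), g2.ones i (by omega) (by omega)])
  let G := gapSwapPerm a b c i.toNat y.1 hS hab habc ha hb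
  have hFG : (F (G x)).1 = gapSwap a b c i.toNat y.1 (F x).1 :=
    congrArg Subtype.val (DFunLike.congr_fun (hcomm G (gapSwapPerm_mem_aut hS hab habc ha hb)) x)
  have g0 : IsGap (F x).1 t (t + c + 1) := hgap (by omega) hx.gap₀
  have g1 : IsGap (F x).1 (t + c + 1) (t + c + a + 2) := hgap (by omega) hx.gap₁
  have hGx : Occurs b a c i.toNat y.1 (G x).1 t := hx.gapSwap hab habc
  have g1' : IsGap (F (G x)).1 (t + c + 1) (t + c + b + 2) := hgap (by omega) hGx.gap₁
  have g2' : IsGap (F (G x)).1 (t + c + b + 2) (t + c + b + a + 3) := hgap (by omega) hGx.gap₂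
  -- The gaps of `F (G x)` are exchanged compared with those of `F x`, and `F (G x) = G (F x)`. So
  -- `G` must act on `F x` at this place, which is possible only if `F x` has the tail of `y` there,
  -- including position `i`.
  have hflip : IsFlip a b c i.toNat y.1 (F x).1 (t + c + a + 2) := by
    by_contra hf
    have h2 := gapSwap_of_not_isFlip hf
    rw [← hFG, g1.right] at h2
    rcases lt_or_gt_of_ne hab with h | h
    · rw [g1'.ones _ (by omega) (by omega)] at h2
      omega
    · rw [g2'.ones _ (by omega) (by omega)] at h2
      omega
  obtain ⟨s, hs, hst⟩ := hflip
  obtain ⟨hts, -⟩ := hs.gap₀.eq_of_overlap g0 (by omega) (by omega)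
  rw [hts] at hs
  refine hFx ?_
  have htail : (F x).1 (t + c + a + b + 3 + i) = y.1 i := by
    rcases hs with hs | hs
    · exact hs.tail i hi (by omega)
    · rw [add_right_comm _ (a : ℤ)]
      exact hs.tail i hi (by omega)
  rw [show t + c + a + b + 3 + i = i by rw [ht]; ring] at htail
  rw [htail, hxy i (by omega)]

/-- A rigid automorphism that commutes with all automorphisms is the identity. -/
theorem IsRigid.eq_one (hS : S.Infinite) (hF : IsRigid hS N F)
    (hcomm : ∀ G ∈ Aut (gapShift S), F * G = G * F) : F = 1 := by
  refine Equiv.ext fun y => Subtype.ext (funext fun i => ?_)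
  -- Only the window around `i` matters. Either its restriction is the all-ones point, or it has a
  -- first zero at most `i + N`, which is shifted to the origin.
  let u := restrictPoint hS y (Set.Icc (i - N) (i + N)) Set.ordConnected_Icc
  have hu : ∀ k, i - N ≤ k → k ≤ i + N → y.1 k = u.1 k := fun k h1 h2 =>
    (restrictPoint_of_mem hS y _ (Set.mem_Icc.2 ⟨h1, h2⟩)).symm
  change _ = y.1 i
  rw [hF.isLocal.congr hu, hu i (by omega) (by omega)]
  by_cases h : ∃ k, u.1 k ≠ 1
  · obtain ⟨k, hk⟩ := h
    have hout : ∀ j, j < i - N → u.1 j = 1 := fun j hj =>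
      restrictPoint_of_notMem hS y _ fun h => by have := (Set.mem_Icc.1 h).1; omega
    obtain ⟨p, hp⟩ := exists_firstZero hout hk
    have hpi : p ≤ i + N := by
      by_contra hlt
      have h2 : u.1 p = 1 :=
        restrictPoint_of_notMem hS y _ fun h => by have := (Set.mem_Icc.1 h).2; omega
      have := hp.zero
      omega
    have hp' : FirstZero (shiftPerm _ p u).1 0 :=
      ⟨by rw [shiftPerm_apply, add_zero, hp.zero],
        fun j hj => by rw [shiftPerm_apply, hp.ones _ (by omega)]⟩
    have := hF.apply_eq_of_firstZero hS hcomm hp' (i := i - p) (by omega)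
    rwa [hF.isLocal.apply_shiftPerm, shiftPerm_apply, add_sub_cancel] at this
  · push Not at h
    rw [show u = onesPoint hS from Subtype.ext (funext h), hF.ones]

theorem centralizer_univ_eq_zpowers (hS : S.Infinite) (hX : ¬ IsSofic (gapShift S)) :
    Subgroup.centralizer (Set.univ : Set (Aut (gapShift S))) =
      Subgroup.zpowers (shiftAut (gapShift S)) := by
  ext F
  rw [Subgroup.mem_centralizer_iff, Subgroup.mem_zpowers_iff]
  constructor
  · intro hF
    obtain ⟨k, N, hN⟩ := exists_isRigid hS hX F.2
    have h1 := hN.eq_one hS fun G hG => by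
      have h2 : G * F.1 = F.1 * G := congrArg Subtype.val (hF ⟨G, hG⟩ trivial)
      rw [mul_assoc, ← h2, ← mul_assoc, shiftPerm_mul_comm _ _ hG, mul_assoc]
    refine ⟨-k, Subtype.ext ?_⟩
    rw [coe_shiftAut_zpow]
    rw [← mul_one (shiftPerm _ (-k)), ← h1, ← mul_assoc, ← shiftPerm_add, neg_add_cancel,
      shiftPerm_zero, one_mul]
  · rintro ⟨k, rfl⟩ G -
    refine Subtype.ext ?_
    rw [Subgroup.coe_mul, Subgroup.coe_mul, coe_shiftAut_zpow, shiftPerm_mul_comm _ _ G.2]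

end Center

/-! ### Conclusion -/

theorem k_eq_top {A : Type*} [TopologicalSpace A] [DiscreteTopology A] [Finite A]
    {X : Subshift A ℤ} (h : ∃ R : Set (Aut X), CentralizerIsShifts X R)
    (hfin : ∀ R : Set (Aut X), R.Finite → ¬ CentralizerIsShifts X R) :
    k X = ((⊤ : ℕ∞) : WithBot ℕ∞) := by
  rw [k, if_pos h, WithBot.coe_inj, sInf_eq_top]
  rintro _ ⟨R, hR, rfl⟩
  exact Set.encard_eq_top_iff.2 fun hR' => hfin R hR' hR

end SymbolicShift

theorem mainTheorem4 (S : Set ℕ) (hS : S.Nonempty)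
    (hX : ¬ SymbolicShift.IsSofic (SymbolicShift.gapShift S)) :
    SymbolicShift.k (SymbolicShift.gapShift S) = ((⊤ : ℕ∞) : WithBot ℕ∞) ∧
    (∃ R : Set (SymbolicShift.Aut (SymbolicShift.gapShift S)),
      Subgroup.centralizer R =
        Subgroup.zpowers (SymbolicShift.shiftAut (SymbolicShift.gapShift S))) ∧
    (∀ R : Set (SymbolicShift.Aut (SymbolicShift.gapShift S)), R.Finite →
      Subgroup.centralizer R ≠
        Subgroup.zpowers (SymbolicShift.shiftAut (SymbolicShift.gapShift S))) := by
  have hinf := SymbolicShift.infinite_of_not_isSofic hS hX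
  have h1 : ∃ R : Set (SymbolicShift.Aut (SymbolicShift.gapShift S)),
      Subgroup.centralizer R =
        Subgroup.zpowers (SymbolicShift.shiftAut (SymbolicShift.gapShift S)) :=
    ⟨_, SymbolicShift.centralizer_univ_eq_zpowers hinf hX⟩
  have h2 := fun (R : Set (SymbolicShift.Aut (SymbolicShift.gapShift S))) (hR : R.Finite) =>
    SymbolicShift.centralizer_ne_zpowers hinf hX hR
  exact ⟨SymbolicShift.k_eq_top h1 h2, h1, h2⟩
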